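/- Identify $\mathbb{CP}^1=\mathbb C\cup\{\infty\}$ with the boundary at infinity of hyperbolic space $\mathbb H^3$. A Jordan curve $C\subset\mathbb{CP}^1$ is a $K$-quasicircle if it is the image of $\mathbb{RP}^1$ under a $K$-quasiconformal homeomorphism of $\mathbb{CP}^1$. Let $\mathrm{CH}(C)\subset\mathbb H^3$ be the smallest closed convex set whose accumulation set at infinity is $C$; its boundary is the union of two properly embedded disks $\partial^\pm\mathrm{CH}(C)$ (which coincide with $\mathrm{CH}(C)$ if $C$ is a round circle), and the width of $C$ is $$w(C)=\sup_{x\in \mathrm{CH}(C)}\bigl(d(x,\partial^-\mathrm{CH}(C))+d(x,\partial^+\mathrm{CH}(C))\bigr)\in[0,\infty].$$ **Theorem.** There exist $M>0$, numbers $K_n\ge 1$ and a sequence of Jordan curves $C_n\subset\mathbb{CP}^1$ $(n\in\mathbb N)$ such that 1. each $C_n$ is a $K_n$-quasicircle, and is a finite union of arcs of circles of $\mathbb{CP}^1$; 2. $w(C_n)<M$ for all $n$; 3. $C_n$ converges in the Hausdorff topology to a closed set $C\subset\mathbb{CP}^1$ that is neither a Jordan curve nor a point; 4. the quasicircle constants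 necessarily tend to infinity: whenever $(K'_n)$ is a sequence such that $C_n$ is a $K'_n$-quasicircle for every $n$, then $K'_n\to\infty$. -/

import Mathlib

open Set Filter Topology MeasureTheory
open scoped ENNReal unitInterval

noncomputable section

namespace JordanWidth

/-- The complex projective line, as the one-point compactification of the complex plane. -/
abbrev CP1 : Type := OnePoint ℂ

/-- Euclidean three-space. -/
abbrev E3 : Type := EuclideanSpace ℝ (Fin 3)

/-- Hyperbolic three-space in the projective (Klein) model: the open unit ball. The geodesics are
the Euclidean straight chords, so hyperbolic convexity is Euclidean convexity, and the boundary at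
infinity is the unit sphere. -/
def H3 : Set E3 := Metric.ball 0 1

/-- The hyperbolic distance (curvature `-1`) in the Klein model:
`cosh d(x, y) = (1 - ⟨x, y⟩) / (√(1 - |x|²) √(1 - |y|²))`. -/
def hypDist (x y : E3) : ℝ :=
  Real.arcosh ((1 - inner ℝ x y) / (√(1 - ‖x‖ ^ 2) * √(1 - ‖y‖ ^ 2)))

/-- Hyperbolic distance from a point to a set. -/
def hypInfDist (x : E3) (A : Set E3) : ℝ≥0∞ := ⨅ y ∈ A, ENNReal.ofReal (hypDist x y)

/-- Inverse stereographic projection, which identifies `CP1` with the unit sphere, that is, with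
the boundary at infinity of hyperbolic three-space. -/
def toSphere (z : CP1) : E3 :=
  z.elim !₂[0, 0, 1] fun w =>
    !₂[2 * w.re / (‖w‖ ^ 2 + 1), 2 * w.im / (‖w‖ ^ 2 + 1), (‖w‖ ^ 2 - 1) / (‖w‖ ^ 2 + 1)]

/-- The real projective line `ℝ ∪ {∞}` inside `CP1`. -/
def RP1 : Set CP1 := insert OnePoint.infty (range fun t : ℝ => (((t : ℂ)) : CP1))

/-- A Jordan curve: the image of a circle under a continuous injective map. -/
def IsJordanCurve (C : Set CP1) : Prop :=
  ∃ g : Circle → CP1, Continuous g ∧ Function.Injective g ∧ range g = C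

/-! ### Convex hull and width -/

/-- The closed convex subsets of hyperbolic space whose accumulation set at infinity is `C`. -/
def IsClosedConvexWithLimit (C : Set CP1) (S : Set E3) : Prop :=
  S ⊆ H3 ∧ closure S ∩ H3 = S ∧ Convex ℝ S ∧ closure S ∩ Metric.sphere 0 1 = toSphere '' C

/-- The convex hull in hyperbolic space of a set in `CP1`: the smallest closed convex subset whose
accumulation set at infinity is `C`. -/
def hull (C : Set CP1) : Set E3 := H3 ∩ ⋂₀ {S | IsClosedConvexWithLimit C S}

/-- The connected components of the complement of the convex hull in hyperbolic space. When `C` is a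
Jordan curve there are exactly two, one facing each of the two regions of `CP1 \ C`. -/
def IsSide (C : Set CP1) (U : Set E3) : Prop :=
  ∃ p ∈ H3 \ hull C, U = connectedComponentIn (H3 \ hull C) p

/-- The frontier in hyperbolic space of `U`. If `U` and `V` are the two sides of the convex hull of a
Jordan curve, then `hypFrontier U` and `hypFrontier V` are the two disks `∂⁺CH(C)` and `∂⁻CH(C)`
whose union is the boundary of the hull (both are the whole hull when `C` is a round circle). -/
def hypFrontier (U : Set E3) : Set E3 := frontier U ∩ H3

/-- The width of a Jordan curve: `sup_{x ∈ CH(C)} (d(x, ∂⁻CH(C)) + d(x, ∂⁺CH(C)))`. -/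
def width (C : Set CP1) : ℝ≥0∞ :=
  ⨆ (x ∈ hull C) (U : Set E3) (V : Set E3) (_ : IsSide C U) (_ : IsSide C V) (_ : U ≠ V),
    hypInfDist x (hypFrontier U) + hypInfDist x (hypFrontier V)

/-! ### Quasiconformal maps, through the modulus of path families -/

/-- The path in `CP1` given by a path in the complex plane. -/
def toCP1 (c : C(I, ℂ)) : C(I, CP1) :=
  ⟨fun t => ((c t : ℂ) : CP1), OnePoint.continuous_coe.comp c.continuous⟩

/-- The length of a path in the complex plane. -/
def pathLength (c : C(I, ℂ)) : ℝ≥0∞ := eVariationOn c univ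

/-- The integral of `ρ` with respect to arc length along a rectifiable path. -/
def lineIntegral (ρ : ℂ → ℝ≥0∞) (c : C(I, ℂ)) : ℝ≥0∞ :=
  ∫⁻ s in Icc (0 : ℝ) (pathLength c).toReal, ρ (naturalParameterization c univ 0 s)

/-- `ρ` is admissible for the path family `Γ`: it is a nonnegative Borel function with integral at
least `1` along each rectifiable path of the family. As usual, only paths that avoid `∞` are
tested. -/
def IsAdmissible (Γ : Set C(I, CP1)) (ρ : ℂ → ℝ≥0∞) : Prop :=
  Measurable ρ ∧ ∀ c : C(I, ℂ), toCP1 c ∈ Γ → pathLength c ≠ ∞ → 1 ≤ lineIntegral ρ c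

/-- The conformal modulus of a family of paths. -/
def modulus (Γ : Set C(I, CP1)) : ℝ≥0∞ :=
  ⨅ (ρ : ℂ → ℝ≥0∞) (_ : IsAdmissible Γ ρ), ∫⁻ z, ρ z ^ 2

/-- The image of a family of paths under a homeomorphism. -/
def imageFamily (f : CP1 ≃ₜ CP1) (Γ : Set C(I, CP1)) : Set C(I, CP1) :=
  (fun γ => (f : C(CP1, CP1)).comp γ) '' Γ

/-- A homeomorphism of `CP1` is `K`-quasiconformal if it changes the modulus of each family of
nonconstant paths by a factor of at most `K` (the geometric definition). Orientation-reversing maps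
are allowed: this makes no difference for images of `RP1`, which complex conjugation preserves. -/
def IsQuasiconformal (K : ℝ) (f : CP1 ≃ₜ CP1) : Prop :=
  1 ≤ K ∧ ∀ Γ : Set C(I, CP1), (∀ γ ∈ Γ, ∃ s t, γ s ≠ γ t) →
    modulus (imageFamily f Γ) ≤ ENNReal.ofReal K * modulus Γ ∧
      modulus Γ ≤ ENNReal.ofReal K * modulus (imageFamily f Γ)

/-- A `K`-quasicircle: a Jordan curve that is the image of `RP1` under a `K`-quasiconformal
homeomorphism of `CP1`. -/
def IsQuasicircle (K : ℝ) (C : Set CP1) : Prop :=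
  IsJordanCurve C ∧ ∃ f : CP1 ≃ₜ CP1, IsQuasiconformal K f ∧ f '' RP1 = C

/-! ### Piecewise circular curves -/

/-- A circle in `CP1` (a round circle or a line together with `∞`): a nonempty section of the sphere
by a plane that is not tangent to it. -/
def IsCircle (S : Set CP1) : Prop :=
  ∃ (n : E3) (d : ℝ), |d| < ‖n‖ ∧ S = {z | inner ℝ n (toSphere z) = d}

/-- An arc of a circle in `CP1`. -/
def IsCircularArc (A : Set CP1) : Prop :=
  ∃ S, IsCircle S ∧ ∃ g : I → CP1, Continuous g ∧ Function.Injective g ∧ range g = A ∧ A ⊆ S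

/-- A set is piecewise circular if it is a finite union of arcs of circles. -/
def IsPiecewiseCircular (C : Set CP1) : Prop :=
  ∃ 𝒜 : Set (Set CP1), 𝒜.Finite ∧ (∀ A ∈ 𝒜, IsCircularArc A) ∧ ⋃₀ 𝒜 = C

/-- Convergence of a sequence of subsets of `CP1` to a subset for the Hausdorff distance of the
chordal metric. -/
def HausdorffTendsto (C : ℕ → Set CP1) (L : Set CP1) : Prop :=
  Tendsto (fun n => Metric.hausdorffEDist (toSphere '' C n) (toSphere '' L)) atTop (𝓝 0)

end JordanWidth

end

/-!
The curves are `C_ε`, for `ε = 1 / (n + 1)`. The graph of a zigzag with slopes `1, -1, 1` is sheared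
horizontally: the part above height `ε` is moved by `4` to the left, and the strip of height `ε`
above the real axis is sheared linearly. The strand that crosses the strip becomes a long, almost
horizontal segment that passes just above the peak of the zigzag at `0`. So four strands come close
to each other at `0`, and around `0` the two regions of the complement alternate in four sectors.

* `C_ε` is the image of the real line under a composition of two shears, a bi-Lipschitz
  homeomorphism of the plane. Such a map distorts moduli by a bounded factor, because it distorts
  arc length and area by bounded factors (`modulus_imageFamily_onePointCongr_le`); so `C_ε` is a
  quasicircle, and it consists of three segments and two rays.
* The angles of all sectors at `0` are bounded below. Hence at each point of the curve and at each
  scale both regions contain disks of comparable size (`corkscrew_below`, `corkscrew_above`). A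
  point `(z, t)` of the convex hull, in half-space coordinates, has a point of the curve within
  distance `2t` of `z`, since otherwise a half-space over a disk would separate it from the curve.
  The half-spaces over the disks lie on the two sides of the hull, so both sides come within bounded
  distance of `(z, t)`, and the width is bounded (`width_le`).
* As `ε → 0`, the peak touches the strand above it. The limit set has the cut point `0`, so it is
  not a Jordan curve (`not_isJordanCurve_limitSet`).
* The reflection in a `K`-quasicircle exchanges the two regions, fixes the curve, and distorts
  moduli by at most `K ^ 2` (`exists_reflection`). The vertical segments between two neighboring
  strands to the left of `0` have modulus at least `log (1 / ε)` up to a constant, by the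
  length-area method (`log_le_modulus_segmentFamily`). Their reflections join the same strands
  through the other region, where they have to go around the triangle cut off by the pinch, so they
  have length at least `1` near `0` and their modulus is bounded (`modulus_reflected_le`). Therefore
  `K → ∞`.
-/

noncomputable section

namespace JordanWidth

open scoped NNReal

/-! ### Arc length of rectifiable paths -/

section ArcLength

variable {E : Type*} [MetricSpace E]

theorem locallyBoundedVariationOn_of_ne_top {c : C(I, E)} (hc : eVariationOn c univ ≠ ∞) :
    LocallyBoundedVariationOn c univ :=
  BoundedVariationOn.locallyBoundedVariationOn hc

/-- Arc length, measured from the initial point, of a path. -/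
def arcLen (c : C(I, E)) (t : I) : ℝ := variationOnFromTo c univ 0 t

theorem arcLen_sub {c : C(I, E)} (hc : eVariationOn c univ ≠ ∞) {a b : I} (hab : a ≤ b) :
    arcLen c b - arcLen c a = (eVariationOn c (Icc a b)).toReal := by
  rw [arcLen, arcLen, variationOnFromTo.sub_right (locallyBoundedVariationOn_of_ne_top hc)
    (mem_univ _) (mem_univ _) (mem_univ _), variationOnFromTo.eq_of_le _ _ hab, univ_inter]

theorem arcLen_zero (c : C(I, E)) : arcLen c 0 = 0 := variationOnFromTo.self _ _ _

theorem arcLen_one (c : C(I, E)) : arcLen c 1 = (eVariationOn c univ).toReal := by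
  rw [arcLen, variationOnFromTo.eq_of_le _ _ zero_le_one, univ_inter]
  congr 2
  ext t
  simp [unitInterval.le_one']

theorem arcLen_mono {c : C(I, E)} (hc : eVariationOn c univ ≠ ∞) : Monotone (arcLen c) := by
  intro a b hab
  have := arcLen_sub hc hab
  have h2 : 0 ≤ (eVariationOn c (Icc a b)).toReal := ENNReal.toReal_nonneg
  linarith

theorem continuous_arcLen {c : C(I, E)} (hc : eVariationOn c univ ≠ ∞) :
    Continuous (arcLen c) := by
  have hb := locallyBoundedVariationOn_of_ne_top hc
  rw [continuous_iff_continuousAt]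
  intro t
  rw [continuousAt_iff_continuous_left'_right']
  constructor
  · have := variationOnFromTo.tendsto_left (mem_univ (0 : I)) (mem_univ t) hb
      (c.continuous.continuousAt.mono_left inf_le_left)
    simpa [ContinuousWithinAt, arcLen, Function.comp_def] using! this
  · have := variationOnFromTo.tendsto_right (mem_univ (0 : I)) (mem_univ t) hb
      (c.continuous.continuousAt.mono_left inf_le_left)
    simpa [ContinuousWithinAt, arcLen, Function.comp_def] using! this

theorem range_arcLen {c : C(I, E)} (hc : eVariationOn c univ ≠ ∞) :
    range (arcLen c) = Icc 0 (eVariationOn c univ).toReal := by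
  apply Subset.antisymm
  · rintro _ ⟨t, rfl⟩
    rw [← arcLen_one, ← arcLen_zero c]
    exact ⟨arcLen_mono hc unitInterval.nonneg', arcLen_mono hc unitInterval.le_one'⟩
  · rw [← arcLen_one, ← arcLen_zero c]
    exact intermediate_value_univ _ _ (continuous_arcLen hc)

theorem dist_le_abs_arcLen_sub {c : C(I, E)} (hc : eVariationOn c univ ≠ ∞) (a b : I) :
    dist (c a) (c b) ≤ |arcLen c a - arcLen c b| := by
  wlog hab : a ≤ b generalizing a b
  · rw [dist_comm, abs_sub_comm]
    exact this b a (le_of_not_ge hab)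
  rw [abs_sub_comm, arcLen_sub hc hab, abs_of_nonneg ENNReal.toReal_nonneg, dist_edist]
  refine ENNReal.toReal_mono (ne_top_of_le_ne_top hc (eVariationOn.mono _ (subset_univ _))) ?_
  exact eVariationOn.edist_le _ ⟨le_rfl, hab⟩ ⟨hab, le_rfl⟩

/-- A parameter of the path at which a given arc length is reached. -/
def arcInv (c : C(I, E)) (s : ℝ) : I :=
  @Function.invFunOn _ _ ⟨0⟩ (variationOnFromTo c univ 0) univ s

theorem naturalParameterization_eq (c : C(I, E)) (s : ℝ) :
    naturalParameterization c univ 0 s = c (arcInv c s) := rfl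

theorem arcLen_arcInv {c : C(I, E)} (hc : eVariationOn c univ ≠ ∞) {s : ℝ}
    (hs : s ∈ Icc 0 (eVariationOn c univ).toReal) : arcLen c (arcInv c s) = s := by
  have hI : Nonempty I := ⟨0⟩
  rw [← range_arcLen hc] at hs
  obtain ⟨t, ht⟩ := hs
  exact (Function.invFunOn_pos (f := variationOnFromTo c univ 0) ⟨t, mem_univ _, ht⟩).2

theorem naturalParameterization_arcLen {c : C(I, E)} (hc : eVariationOn c univ ≠ ∞) (t : I) :
    naturalParameterization c univ 0 (arcLen c t) = c t := by
  have := edist_naturalParameterization_eq_zero (locallyBoundedVariationOn_of_ne_top hc)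
    (mem_univ (0 : I)) (mem_univ t)
  exact edist_eq_zero.1 this

theorem lipschitzOnWith_naturalParameterization {c : C(I, E)} (hc : eVariationOn c univ ≠ ∞) :
    LipschitzOnWith 1 (naturalParameterization c univ 0)
      (Icc 0 (eVariationOn c univ).toReal) := by
  refine LipschitzOnWith.of_dist_le_mul fun x hx y hy => ?_
  rw [NNReal.coe_one, one_mul, naturalParameterization_eq, naturalParameterization_eq]
  refine (dist_le_abs_arcLen_sub hc _ _).trans_eq ?_
  rw [arcLen_arcInv hc hx, arcLen_arcInv hc hy, Real.dist_eq]

/-- Integration over the image of a Lipschitz map of the line. -/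
theorem lintegral_image_le_of_lipschitzOnWith {A : Set ℝ} (hA : MeasurableSet A) {θ : ℝ → ℝ}
    {L : ℝ≥0} (hθ : LipschitzOnWith L θ A) {g : ℝ → ℝ≥0∞} (hg : Measurable g) :
    ∫⁻ s in θ '' A, g s ≤ L * ∫⁻ s in A, g (θ s) := by
  have hm : AEMeasurable θ (volume.restrict A) := hθ.continuousOn.aemeasurable hA
  have hle : volume.restrict (θ '' A) ≤ (L : ℝ≥0∞) • Measure.map θ (volume.restrict A) := by
    refine Measure.le_iff.2 fun B hB => ?_
    rw [Measure.restrict_apply hB, Measure.smul_apply, Measure.map_apply_of_aemeasurable hm hB,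
      Measure.restrict_apply' hA, smul_eq_mul]
    have hsub : B ∩ θ '' A ⊆ θ '' (θ ⁻¹' B ∩ A) := by
      rintro _ ⟨hb, a, ha, rfl⟩
      exact ⟨a, ⟨hb, ha⟩, rfl⟩
    refine (measure_mono hsub).trans ?_
    have := (hθ.mono (inter_subset_right (s := θ ⁻¹' B))).hausdorffMeasure_image_le
      (d := 1) zero_le_one
    simpa [hausdorffMeasure_real] using this
  refine (lintegral_mono' hle le_rfl).trans ?_
  rw [lintegral_smul_measure, lintegral_map' hg.aemeasurable hm, smul_eq_mul]

/-- If the length of `c` is controlled by that of `c'` on each parameter interval, then integrals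
along `c` are controlled by integrals along `c'`. -/
theorem lintegral_naturalParameterization_le {E' : Type*} [MetricSpace E'] [MeasurableSpace E]
    [BorelSpace E] {c : C(I, E)} {c' : C(I, E')} (hc : eVariationOn c univ ≠ ∞)
    (hc' : eVariationOn c' univ ≠ ∞) {L : ℝ≥0}
    (hL : ∀ a b, eVariationOn c (Icc a b) ≤ L * eVariationOn c' (Icc a b))
    {G : E → ℝ≥0∞} {G' : E' → ℝ≥0∞} (hG : Measurable G) (hGG : ∀ t, G (c t) = G' (c' t)) :
    ∫⁻ s in Icc 0 (eVariationOn c univ).toReal, G (naturalParameterization c univ 0 s) ≤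
      L * ∫⁻ s in Icc 0 (eVariationOn c' univ).toReal,
        G' (naturalParameterization c' univ 0 s) := by
  set ℓ := (eVariationOn c univ).toReal with hℓ
  set ℓ' := (eVariationOn c' univ).toReal with hℓ'
  have h0 : (0 : ℝ) ≤ ℓ := ENNReal.toReal_nonneg
  set θ : ℝ → ℝ := fun s => arcLen c (arcInv c' s) with hθ
  have hle : ∀ a b : I, |arcLen c a - arcLen c b| ≤ L * |arcLen c' a - arcLen c' b| := by
    intro a b
    wlog hab : a ≤ b generalizing a b
    · rw [abs_sub_comm, abs_sub_comm (arcLen c' a)]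
      exact this b a (le_of_not_ge hab)
    rw [abs_sub_comm, abs_sub_comm (arcLen c' a), arcLen_sub hc hab, arcLen_sub hc' hab,
      abs_of_nonneg ENNReal.toReal_nonneg, abs_of_nonneg ENNReal.toReal_nonneg,
      ← ENNReal.coe_toReal, ← ENNReal.toReal_mul]
    refine ENNReal.toReal_mono (ENNReal.mul_ne_top ENNReal.coe_ne_top ?_) (hL a b)
    exact ne_top_of_le_ne_top hc' (eVariationOn.mono _ (subset_univ _))
  have hlip : LipschitzOnWith L θ (Icc 0 ℓ') := by
    refine LipschitzOnWith.of_dist_le_mul fun x hx y hy => ?_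
    refine (hle _ _).trans_eq ?_
    rw [arcLen_arcInv hc' hx, arcLen_arcInv hc' hy, Real.dist_eq]
  have himg : Icc 0 ℓ ⊆ θ '' Icc 0 ℓ' := by
    intro s hs
    rw [hℓ, ← range_arcLen hc] at hs
    obtain ⟨t, rfl⟩ := hs
    have ht : arcLen c' t ∈ Icc 0 ℓ' := by
      rw [hℓ', ← range_arcLen hc']
      exact mem_range_self t
    refine ⟨arcLen c' t, ht, ?_⟩
    have := hle (arcInv c' (arcLen c' t)) t
    rw [arcLen_arcInv hc' ht, sub_self, abs_zero, mul_zero] at this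
    exact sub_eq_zero.1 (abs_eq_zero.1 (le_antisymm this (abs_nonneg _)))
  -- The natural parameterization extended continuously, so that the integrand is measurable.
  set n : ℝ → E := IccExtend h0 ((Icc 0 ℓ).domRestrict (naturalParameterization c univ 0)) with hn
  have hncont : Continuous n :=
    (continuousOn_iff_continuous_domRestrict.1
      (lipschitzOnWith_naturalParameterization hc).continuousOn).Icc_extend'
  have hneq : ∀ s ∈ Icc 0 ℓ, n s = naturalParameterization c univ 0 s := by
    intro s hs
    rw [hn, IccExtend_of_mem h0 _ hs]
    rfl
  calc ∫⁻ s in Icc 0 ℓ, G (naturalParameterization c univ 0 s)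
      = ∫⁻ s in Icc 0 ℓ, G (n s) :=
        setLIntegral_congr_fun measurableSet_Icc fun s hs => by rw [hneq s hs]
    _ ≤ ∫⁻ s in θ '' Icc 0 ℓ', G (n s) := lintegral_mono_set himg
    _ ≤ L * ∫⁻ s in Icc 0 ℓ', G (n (θ s)) :=
        lintegral_image_le_of_lipschitzOnWith measurableSet_Icc hlip (hG.comp hncont.measurable)
    _ = L * ∫⁻ s in Icc 0 ℓ', G' (naturalParameterization c' univ 0 s) := by
        congr 1
        refine setLIntegral_congr_fun measurableSet_Icc fun s hs => ?_
        have hmem : θ s ∈ Icc 0 ℓ := by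
          rw [hℓ, ← range_arcLen hc]
          exact mem_range_self _
        change G (n (θ s)) = _
        rw [hneq _ hmem, naturalParameterization_arcLen hc, hGG, naturalParameterization_eq]

end ArcLength

/-! ### Bi-Lipschitz maps are quasiconformal -/

/-- A Lipschitz homeomorphism of the plane changes planar integrals by a bounded factor. -/
theorem lintegral_comp_symm_le (F : ℂ ≃ₜ ℂ) {L : ℝ≥0} (hF : LipschitzWith L F)
    (g : ℂ → ℝ≥0∞) (hg : Measurable g) :
    ∫⁻ z, g (F.symm z) ≤ (L : ℝ≥0∞) ^ 2 * ∫⁻ z, g z := by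
  set μ : Measure ℂ := Measure.hausdorffMeasure (Module.finrank ℝ ℂ : ℝ) with hμ
  have hfr : Module.finrank ℝ ℂ = 2 := Complex.finrank_real_complex
  obtain ⟨k, hk⟩ : ∃ k : ℝ≥0, (volume : Measure ℂ) = k • μ :=
    ⟨_, Measure.isAddLeftInvariant_eq_smul _ _⟩
  have hle : Measure.map F.symm (volume : Measure ℂ) ≤ ((L : ℝ≥0∞) ^ 2) • (volume : Measure ℂ) := by
    refine Measure.le_iff.2 fun B hB => ?_
    rw [Measure.map_apply F.symm.continuous.measurable hB, Measure.smul_apply, smul_eq_mul, hk,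
      Measure.smul_apply, Measure.smul_apply, ← F.image_eq_preimage_symm]
    have := hF.hausdorffMeasure_image_le (d := (Module.finrank ℝ ℂ : ℝ)) (by positivity) B
    rw [← hμ] at this
    calc k • μ (F '' B) ≤ k • ((L : ℝ≥0∞) ^ ((Module.finrank ℝ ℂ : ℕ) : ℝ) * μ B) := by gcongr
      _ = (L : ℝ≥0∞) ^ 2 * k • μ B := by
        rw [hfr, ENNReal.rpow_natCast, ENNReal.smul_def, ENNReal.smul_def, smul_eq_mul,
          smul_eq_mul]
        ring
  calc ∫⁻ z, g (F.symm z) = ∫⁻ z, g z ∂(Measure.map F.symm volume) :=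
        (lintegral_map hg F.symm.continuous.measurable).symm
    _ ≤ ∫⁻ z, g z ∂(((L : ℝ≥0∞) ^ 2) • (volume : Measure ℂ)) := lintegral_mono' hle le_rfl
    _ = _ := by rw [lintegral_smul_measure, smul_eq_mul]

/-- A homeomorphism of the plane that is bi-Lipschitz with constant `L` multiplies moduli by at most
`L ^ 4`: densities are transported by `ρ ↦ L · ρ ∘ F⁻¹`. -/
theorem modulus_imageFamily_onePointCongr_le (F : ℂ ≃ₜ ℂ) {L : ℝ≥0} (hL : L ≠ 0)
    (hF : LipschitzWith L F) (hF' : LipschitzWith L F.symm) (Γ : Set C(I, CP1)) :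
    modulus (imageFamily F.onePointCongr Γ) ≤ (L : ℝ≥0∞) ^ 4 * modulus Γ := by
  have hne : (L : ℝ≥0∞) ^ 4 ≠ ∞ := ENNReal.pow_ne_top ENNReal.coe_ne_top
  have h0 : (L : ℝ≥0∞) ^ 4 ≠ 0 := by simpa using hL
  conv_rhs => rw [modulus]
  rw [ENNReal.mul_iInf_of_ne h0 hne]
  refine le_iInf fun ρ => ?_
  rw [ENNReal.mul_iInf_of_ne h0 hne]
  refine le_iInf fun hρ => ?_
  have hadm : IsAdmissible (imageFamily F.onePointCongr Γ) fun w => L * ρ (F.symm w) := by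
    refine ⟨(hρ.1.comp F.symm.continuous.measurable).const_mul _, fun c hc hlen => ?_⟩
    obtain ⟨γ, hγ, hγc⟩ := hc
    set d : C(I, ℂ) := (F.symm : C(ℂ, ℂ)).comp c with hd
    have hdΓ : toCP1 d ∈ Γ := by
      convert hγ using 1
      ext1 t
      have := congrArg (fun e : C(I, CP1) => F.onePointCongr.symm (e t)) hγc
      simp only [ContinuousMap.comp_apply] at this
      exact (this.symm.trans (F.onePointCongr.symm_apply_apply (γ t)) :)
    have hdle : ∀ s, eVariationOn d s ≤ L * eVariationOn c s := fun s =>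
      hF'.lipschitzOnWith.comp_eVariationOn_le (mapsTo_univ _ _)
    have hdlen : pathLength d ≠ ∞ :=
      ne_top_of_le_ne_top (ENNReal.mul_ne_top ENNReal.coe_ne_top hlen) (hdle univ)
    refine (hρ.2 d hdΓ hdlen).trans ?_
    refine (lintegral_naturalParameterization_le (c' := c) (L := L) hdlen hlen
      (fun a b => hdle _) hρ.1 (G' := fun w => ρ (F.symm w)) fun t => rfl).trans_eq ?_
    rw [lineIntegral, lintegral_const_mul' _ _ ENNReal.coe_ne_top]
    rfl
  calc modulus (imageFamily F.onePointCongr Γ)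
      ≤ ∫⁻ w, (L * ρ (F.symm w)) ^ 2 := iInf₂_le _ hadm
    _ = (L : ℝ≥0∞) ^ 2 * ∫⁻ w, ρ (F.symm w) ^ 2 := by
        simp_rw [mul_pow]
        exact lintegral_const_mul' _ _ (ENNReal.pow_ne_top ENNReal.coe_ne_top)
    _ ≤ (L : ℝ≥0∞) ^ 2 * ((L : ℝ≥0∞) ^ 2 * ∫⁻ w, ρ w ^ 2) := by
        gcongr
        exact lintegral_comp_symm_le F hF (fun z => ρ z ^ 2) (hρ.1.pow_const 2)
    _ = (L : ℝ≥0∞) ^ 4 * ∫⁻ w, ρ w ^ 2 := by ring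

/-- Bi-Lipschitz homeomorphisms of the plane extend to quasiconformal homeomorphisms of `CP1`. -/
theorem isQuasiconformal_onePointCongr (F : ℂ ≃ₜ ℂ) {L : ℝ≥0} (hL : 1 ≤ L)
    (hF : LipschitzWith L F) (hF' : LipschitzWith L F.symm) :
    IsQuasiconformal ((L : ℝ) ^ 4) F.onePointCongr := by
  have hL0 : L ≠ 0 := (zero_lt_one.trans_le hL).ne'
  have hK : ENNReal.ofReal ((L : ℝ) ^ 4) = (L : ℝ≥0∞) ^ 4 := by
    rw [ENNReal.ofReal_pow L.coe_nonneg, ENNReal.ofReal_coe_nnreal]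
  refine ⟨one_le_pow₀ (by exact_mod_cast hL), fun Γ _ => ?_⟩
  rw [hK]
  refine ⟨modulus_imageFamily_onePointCongr_le F hL0 hF hF' Γ, ?_⟩
  have := modulus_imageFamily_onePointCongr_le F.symm hL0 hF' hF
    (imageFamily F.onePointCongr Γ)
  convert this using 2
  rw [imageFamily, imageFamily, image_image]
  convert (image_id Γ).symm using 2 with γ
  ext1 t
  exact F.onePointCongr.symm_apply_apply (γ t)

/-! ### The upper half-space in the Klein model -/

/-- The point of the Klein ball that corresponds to the point `(z, t)` of the upper half-space
`ℂ × (0, ∞)`. For `t = 0` this is inverse stereographic projection. -/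
def halfSpacePt (z : ℂ) (t : ℝ) : E3 :=
  !₂[2 * z.re / (‖z‖ ^ 2 + t ^ 2 + 1), 2 * z.im / (‖z‖ ^ 2 + t ^ 2 + 1),
    (‖z‖ ^ 2 + t ^ 2 - 1) / (‖z‖ ^ 2 + t ^ 2 + 1)]

theorem toSphere_coe (z : ℂ) : toSphere (z : CP1) = halfSpacePt z 0 := by
  simp [toSphere, halfSpacePt]

theorem toSphere_infty : toSphere OnePoint.infty = !₂[0, 0, 1] := rfl

theorem inner_E3 (x y : E3) : inner ℝ x y = x 0 * y 0 + x 1 * y 1 + x 2 * y 2 := by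
  simp [PiLp.inner_apply, Fin.sum_univ_three, mul_comm]

theorem norm_sq_E3 (x : E3) : ‖x‖ ^ 2 = x 0 ^ 2 + x 1 ^ 2 + x 2 ^ 2 := by
  simp [EuclideanSpace.norm_sq_eq, Fin.sum_univ_three]

theorem norm_sq_C (z : ℂ) : ‖z‖ ^ 2 = z.re ^ 2 + z.im ^ 2 := by
  rw [← Complex.normSq_eq_norm_sq, Complex.normSq_apply]; ring

theorem one_sub_inner_halfSpacePt (z w : ℂ) (t s : ℝ) :
    1 - inner ℝ (halfSpacePt z t) (halfSpacePt w s) =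
      2 * (‖z - w‖ ^ 2 + t ^ 2 + s ^ 2) / ((‖z‖ ^ 2 + t ^ 2 + 1) * (‖w‖ ^ 2 + s ^ 2 + 1)) := by
  have h1 : ‖z‖ ^ 2 + t ^ 2 + 1 ≠ 0 := by positivity
  have h2 : ‖w‖ ^ 2 + s ^ 2 + 1 ≠ 0 := by positivity
  rw [inner_E3]
  simp only [halfSpacePt, PiLp.toLp_apply, Matrix.cons_val]
  field_simp
  rw [norm_sq_C, norm_sq_C, norm_sq_C, Complex.sub_re, Complex.sub_im]
  ring

theorem one_sub_norm_sq_halfSpacePt (z : ℂ) (t : ℝ) :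
    1 - ‖halfSpacePt z t‖ ^ 2 = (2 * t / (‖z‖ ^ 2 + t ^ 2 + 1)) ^ 2 := by
  rw [← real_inner_self_eq_norm_sq, one_sub_inner_halfSpacePt, sub_self, norm_zero]
  field_simp
  ring

theorem halfSpacePt_mem_H3 (z : ℂ) {t : ℝ} (ht : 0 < t) : halfSpacePt z t ∈ H3 := by
  have h := one_sub_norm_sq_halfSpacePt z t
  have : 0 < (2 * t / (‖z‖ ^ 2 + t ^ 2 + 1)) ^ 2 := by positivity
  rw [H3, mem_ball_zero_iff]
  nlinarith [norm_nonneg (halfSpacePt z t)]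

theorem norm_toSphere (z : CP1) : ‖toSphere z‖ = 1 := by
  have h : ‖toSphere z‖ ^ 2 = 1 := by
    induction z using OnePoint.rec with
    | infty => simp [toSphere_infty, norm_sq_E3]
    | coe z =>
      have := one_sub_norm_sq_halfSpacePt z 0
      rw [toSphere_coe]
      norm_num at this
      linarith
  exact (pow_eq_one_iff_of_nonneg (norm_nonneg _) two_ne_zero).1 h

/-- Every interior point of the ball comes from the upper half-space. -/
theorem exists_eq_halfSpacePt {x : E3} (hx : x ∈ H3) :
    ∃ (z : ℂ) (t : ℝ), 0 < t ∧ x = halfSpacePt z t := by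
  rw [H3, mem_ball_zero_iff] at hx
  have h1 : ‖x‖ ^ 2 < 1 := by nlinarith [norm_nonneg x]
  have hs := norm_sq_E3 x
  have h2 : x 2 < 1 := by nlinarith [sq_nonneg (x 0), sq_nonneg (x 1)]
  have h3 : 0 < 1 - x 2 := by linarith
  have ht : 0 < √(1 - ‖x‖ ^ 2) := Real.sqrt_pos.2 (by linarith)
  have hsq : √(1 - ‖x‖ ^ 2) ^ 2 = 1 - ‖x‖ ^ 2 := Real.sq_sqrt (by linarith)
  refine ⟨⟨x 0 / (1 - x 2), x 1 / (1 - x 2)⟩, √(1 - ‖x‖ ^ 2) / (1 - x 2), by positivity, ?_⟩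
  have hD : ‖(⟨x 0 / (1 - x 2), x 1 / (1 - x 2)⟩ : ℂ)‖ ^ 2 + (√(1 - ‖x‖ ^ 2) / (1 - x 2)) ^ 2 + 1
      = 2 / (1 - x 2) := by
    rw [norm_sq_C, div_pow, div_pow, div_pow, hsq, hs]
    field_simp
    ring
  ext i
  fin_cases i
  · simp only [halfSpacePt, hD, PiLp.toLp_apply]
    simp
    field_simp
  · simp only [halfSpacePt, hD, PiLp.toLp_apply]
    simp
    field_simp
  · have hD' := eq_sub_of_add_eq hD
    simp only [halfSpacePt, hD, PiLp.toLp_apply]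
    simp [hD']
    field_simp
    ring

theorem hypDist_halfSpacePt (z w : ℂ) {t s : ℝ} (ht : 0 < t) (hs : 0 < s) :
    hypDist (halfSpacePt z t) (halfSpacePt w s) =
      Real.arcosh ((‖z - w‖ ^ 2 + t ^ 2 + s ^ 2) / (2 * t * s)) := by
  rw [hypDist, one_sub_inner_halfSpacePt, one_sub_norm_sq_halfSpacePt,
    one_sub_norm_sq_halfSpacePt, Real.sqrt_sq (by positivity), Real.sqrt_sq (by positivity)]
  congr 1
  field_simp

theorem continuous_halfSpacePt : Continuous fun p : ℂ × ℝ => halfSpacePt p.1 p.2 := by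
  refine (PiLp.continuous_toLp 2 _).comp (continuous_pi fun i => ?_)
  fin_cases i
  · exact Continuous.div (by fun_prop) (by fun_prop) fun p => by positivity
  · exact Continuous.div (by fun_prop) (by fun_prop) fun p => by positivity
  · exact Continuous.div (by fun_prop) (by fun_prop) fun p => by positivity

theorem dist_toSphere_infty (z : ℂ) :
    dist (toSphere z) (toSphere OnePoint.infty) ^ 2 = 4 / (‖z‖ ^ 2 + 1) := by
  have h1 : ‖z‖ ^ 2 + 1 ≠ 0 := by positivity
  rw [dist_eq_norm, norm_sq_E3, toSphere_coe, toSphere_infty]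
  simp only [halfSpacePt, PiLp.sub_apply, Matrix.cons_val]
  field_simp
  rw [norm_sq_C]
  ring

theorem continuous_toSphere : Continuous toSphere := by
  rw [continuous_iff_continuousAt]
  intro z
  induction z using OnePoint.rec with
  | infty =>
    rw [OnePoint.continuousAt_infty', Function.comp_def, tendsto_iff_dist_tendsto_zero]
    have h1 : Tendsto (fun z : ℂ => 4 / (‖z‖ ^ 2 + 1)) (coclosedCompact ℂ) (𝓝 0) := by
      rw [coclosedCompact_eq_cocompact]
      refine Tendsto.const_div_atTop (tendsto_atTop_add_const_right _ _ ?_) _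
      exact (tendsto_pow_atTop two_ne_zero).comp (tendsto_norm_cocompact_atTop (E := ℂ))
    have h2 := (Real.continuous_sqrt.tendsto 0).comp h1
    rw [Real.sqrt_zero] at h2
    refine h2.congr fun z => ?_
    rw [Function.comp_apply, ← dist_toSphere_infty, Real.sqrt_sq dist_nonneg]
  | coe z =>
    rw [OnePoint.continuousAt_coe]
    have : toSphere ∘ ((↑) : ℂ → CP1) = fun z => halfSpacePt z 0 := funext toSphere_coe
    rw [this]
    exact (continuous_halfSpacePt.comp (Continuous.prodMk_left 0)).continuousAt

theorem toSphere_injective : Function.Injective toSphere := by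
  intro z w h
  induction z using OnePoint.rec with
  | infty =>
    induction w using OnePoint.rec with
    | infty => rfl
    | coe w =>
      have := dist_toSphere_infty w
      rw [h, dist_self] at this
      have h2 : 0 < 4 / (‖w‖ ^ 2 + 1) := by positivity
      norm_num at this
      linarith
  | coe z =>
    induction w using OnePoint.rec with
    | infty =>
      have := dist_toSphere_infty z
      rw [h, dist_self] at this
      have h2 : 0 < 4 / (‖z‖ ^ 2 + 1) := by positivity
      norm_num at this
      linarith
    | coe w =>
      have h1 := one_sub_inner_halfSpacePt z w 0 0
      rw [← toSphere_coe, ← toSphere_coe, h, real_inner_self_eq_norm_sq, norm_toSphere] at h1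
      have h2 : 0 < (‖z‖ ^ 2 + 0 ^ 2 + 1) * (‖w‖ ^ 2 + 0 ^ 2 + 1) := by positivity
      rw [eq_comm, div_eq_iff h2.ne'] at h1
      have h3 : ‖z - w‖ = 0 := by
        have : ‖z - w‖ ^ 2 = 0 := by linarith
        simpa using this
      rw [sub_eq_zero.1 (norm_eq_zero.1 h3)]

/-- Points of the unit sphere come from `CP1`. -/
theorem exists_eq_toSphere {x : E3} (hx : ‖x‖ = 1) : ∃ z, x = toSphere z := by
  have hs := norm_sq_E3 x
  rw [hx] at hs
  by_cases h : x 2 = 1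
  · refine ⟨OnePoint.infty, ?_⟩
    rw [h] at hs
    have h0 : x 0 = 0 := by nlinarith [sq_nonneg (x 0), sq_nonneg (x 1)]
    have h1 : x 1 = 0 := by nlinarith [sq_nonneg (x 0), sq_nonneg (x 1)]
    ext i
    fin_cases i <;> simp [toSphere_infty, h0, h1, h]
  · have h3 : 1 - x 2 ≠ 0 := fun h' => h (by linarith)
    refine ⟨((⟨x 0 / (1 - x 2), x 1 / (1 - x 2)⟩ : ℂ) : CP1), ?_⟩
    have hD : ‖(⟨x 0 / (1 - x 2), x 1 / (1 - x 2)⟩ : ℂ)‖ ^ 2 + 0 ^ 2 + 1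
        = 2 / (1 - x 2) := by
      rw [norm_sq_C, div_pow, div_pow]
      field_simp
      linarith
    have hD' := eq_sub_of_add_eq hD
    rw [toSphere_coe]
    ext i
    fin_cases i
    · simp only [halfSpacePt, hD, PiLp.toLp_apply]
      simp
      field_simp
    · simp only [halfSpacePt, hD, PiLp.toLp_apply]
      simp
      field_simp
    · simp only [halfSpacePt, hD', PiLp.toLp_apply]
      simp
      field_simp
      ring

/-! ### The convex hull -/

theorem mem_of_mem_closure_convexHull_of_norm_eq_one {C : Set CP1} (hC : IsClosed C)
    (hne : C.Nonempty) {x : E3} (hx : x ∈ closure (convexHull ℝ (toSphere '' C)))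
    (h1 : ‖x‖ = 1) : x ∈ toSphere '' C := by
  by_contra hn
  -- By compactness the linear form `⟨x, ·⟩` stays away from `1 = ⟨x, x⟩` on the set.
  obtain ⟨c₀, hc₀, hmax⟩ := hC.isCompact.exists_isMaxOn hne
    (continuous_const.inner continuous_toSphere :
      Continuous fun c => inner ℝ x (toSphere c)).continuousOn
  have hlt : inner ℝ x (toSphere c₀) < 1 := by
    refine (inner_lt_one_iff_real_of_norm_eq_one h1 (norm_toSphere c₀)).2 ?_
    rintro rfl
    exact hn ⟨c₀, hc₀, rfl⟩
  have hsub : convexHull ℝ (toSphere '' C) ⊆ {y | inner ℝ x y ≤ inner ℝ x (toSphere c₀)} := by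
    refine convexHull_min ?_ (convex_halfSpace_le (innerSL ℝ x).toLinearMap.isLinear _)
    rintro _ ⟨c, hc, rfl⟩
    exact hmax hc
  have hcl : IsClosed {y | inner ℝ x y ≤ inner ℝ x (toSphere c₀)} :=
    isClosed_le (continuous_const.inner continuous_id) continuous_const
  have : inner ℝ x x ≤ inner ℝ x (toSphere c₀) := closure_minimal hsub hcl hx
  rw [real_inner_self_eq_norm_sq, h1] at this
  linarith

/-- The closed Euclidean convex hull of a closed set of at least two ideal points is a closed convex
set whose accumulation set at infinity is that set. -/
theorem isClosedConvexWithLimit_convexHull {C : Set CP1} (hC : IsClosed C) (hnt : C.Nontrivial) :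
    IsClosedConvexWithLimit C (H3 ∩ closure (convexHull ℝ (toSphere '' C))) := by
  have hcl : closure (H3 ∩ closure (convexHull ℝ (toSphere '' C))) ⊆
      closure (convexHull ℝ (toSphere '' C)) :=
    closure_minimal inter_subset_right isClosed_closure
  refine ⟨inter_subset_left, ?_, (convex_ball _ _).inter (convex_convexHull _ _).closure, ?_⟩
  · exact Subset.antisymm (fun x hx => ⟨hx.2, hcl hx.1⟩) fun x hx => ⟨subset_closure hx, hx.1⟩
  · refine Subset.antisymm (fun x hx => ?_) ?_
    · exact mem_of_mem_closure_convexHull_of_norm_eq_one hC hnt.nonempty (hcl hx.1)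
        (mem_sphere_zero_iff_norm.1 hx.2)
    · rintro _ ⟨c, hc, rfl⟩
      refine ⟨?_, mem_sphere_zero_iff_norm.2 (norm_toSphere c)⟩
      obtain ⟨c', hc', hne⟩ := hnt.exists_ne c
      have hmem : ∀ z, toSphere z ∈ Metric.closedBall (0 : E3) 1 := fun z =>
        mem_closedBall_zero_iff.2 (norm_toSphere z).le
      have hseg : openSegment ℝ (toSphere c) (toSphere c') ⊆
          H3 ∩ closure (convexHull ℝ (toSphere '' C)) := by
        refine subset_inter (openSegment_subset_ball_of_ne (hmem c) (hmem c')
          (toSphere_injective.ne hne.symm)) ?_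
        refine Subset.trans ?_ subset_closure
        exact (openSegment_subset_segment _ _ _).trans ((convex_convexHull _ _).segment_subset
          (subset_convexHull _ _ ⟨c, hc, rfl⟩) (subset_convexHull _ _ ⟨c', hc', rfl⟩))
      refine closure_mono hseg ?_
      rw [closure_openSegment]
      exact left_mem_segment _ _ _

/-- The hull lies in each half-space whose closure contains `C`. -/
theorem inner_le_of_mem_hull {C : Set CP1} (hC : IsClosed C) (hnt : C.Nontrivial) {n : E3} {d : ℝ}
    (hd : ∀ c ∈ C, inner ℝ n (toSphere c) ≤ d) {y : E3} (hy : y ∈ hull C) : inner ℝ n y ≤ d := by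
  have h1 := hy.2 _ (isClosedConvexWithLimit_convexHull hC hnt)
  have hsub : closure (convexHull ℝ (toSphere '' C)) ⊆ {y | inner ℝ n y ≤ d} := by
    refine closure_minimal ?_ (isClosed_le (continuous_const.inner continuous_id) continuous_const)
    refine convexHull_min ?_ (convex_halfSpace_le (innerSL ℝ n).toLinearMap.isLinear d)
    rintro _ ⟨c, hc, rfl⟩
    exact hd c hc
  exact hsub h1.2

theorem exists_separating_of_notMem_hull {C : Set CP1} {p : E3} (hp : p ∈ H3 \ hull C) :
    ∃ (n : E3) (d : ℝ), (∀ c ∈ C, inner ℝ n (toSphere c) < d) ∧ d < inner ℝ n p := by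
  obtain ⟨hp1, hp2⟩ := hp
  have : ∃ S, IsClosedConvexWithLimit C S ∧ p ∉ S := by
    by_contra! h
    exact hp2 ⟨hp1, fun S hS => h S hS⟩
  obtain ⟨S, hS, hpS⟩ := this
  have hpc : p ∉ closure S := fun h => hpS (hS.2.1 ▸ ⟨h, hp1⟩)
  obtain ⟨f, u, hf, hu⟩ := geometric_hahn_banach_closed_point hS.2.2.1.closure isClosed_closure hpc
  refine ⟨(InnerProductSpace.toDual ℝ E3).symm f, u, fun c hc => ?_, ?_⟩
  · rw [InnerProductSpace.toDual_symm_apply]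
    refine hf _ ?_
    have : toSphere c ∈ closure S ∩ Metric.sphere 0 1 := hS.2.2.2 ▸ ⟨c, hc, rfl⟩
    exact this.1
  · rwa [InnerProductSpace.toDual_symm_apply]

/-- The hyperbolic half-space over a disk that misses `C` misses the hull. -/
theorem halfSpacePt_notMem_hull {C : Set CP1} (hC : IsClosed C) (hnt : C.Nontrivial) {w : ℂ}
    {r t : ℝ} (ht : 0 < t) (htr : t < r) (hr : ∀ c : ℂ, (c : CP1) ∈ C → r ≤ ‖c - w‖) :
    halfSpacePt w t ∉ hull C := by
  -- The linear form that is larger than `d` exactly over the disk of radius `r` around `w`.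
  set n : E3 := !₂[2 * w.re, 2 * w.im, ‖w‖ ^ 2 - r ^ 2 - 1] with hn
  set d : ℝ := 1 + ‖w‖ ^ 2 - r ^ 2 with hd
  have key : ∀ (ζ : ℂ) (τ : ℝ), d - inner ℝ n (halfSpacePt ζ τ) =
      2 * (‖ζ - w‖ ^ 2 + τ ^ 2 - r ^ 2) / (‖ζ‖ ^ 2 + τ ^ 2 + 1) := by
    intro ζ τ
    have h1 : ‖ζ‖ ^ 2 + τ ^ 2 + 1 ≠ 0 := by positivity
    rw [inner_E3]
    simp only [halfSpacePt, hn, hd, PiLp.toLp_apply, Matrix.cons_val]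
    field_simp
    rw [norm_sq_C, norm_sq_C, norm_sq_C, Complex.sub_re, Complex.sub_im]
    ring
  intro hmem
  have hle : inner ℝ n (halfSpacePt w t) ≤ d := by
    refine inner_le_of_mem_hull hC hnt (fun c hc => ?_) hmem
    induction c using OnePoint.rec with
    | infty =>
      rw [toSphere_infty, inner_E3]
      simp [hn, hd]
      linarith
    | coe c =>
      have h1 := key c 0
      have h2 := hr c hc
      have h3 : 0 ≤ 2 * (‖c - w‖ ^ 2 + 0 ^ 2 - r ^ 2) / (‖c‖ ^ 2 + 0 ^ 2 + 1) := by
        have : r ^ 2 ≤ ‖c - w‖ ^ 2 := pow_le_pow_left₀ (by linarith) h2 2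
        apply div_nonneg _ (by positivity)
        linarith
      rw [toSphere_coe]
      linarith
  have h1 := key w t
  have h2 : 2 * (‖w - w‖ ^ 2 + t ^ 2 - r ^ 2) / (‖w‖ ^ 2 + t ^ 2 + 1) < 0 := by
    apply div_neg_of_neg_of_pos _ (by positivity)
    rw [sub_self, norm_zero]
    nlinarith
  linarith

/-! ### The sides of the hull -/

/-- The points of half-space over a plane region whose height is less than the distance of their
foot to the complement of the region. Each of them lies in the half-space over a disk contained in
the region. -/
def thickening (Ω : Set ℂ) : Set E3 :=
  (fun p : ℂ × ℝ => halfSpacePt p.1 (p.2 * Metric.infDist p.1 Ωᶜ)) '' (Ω ×ˢ Ioo 0 1)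

theorem isPreconnected_thickening {Ω : Set ℂ} (hΩ : IsPreconnected Ω) :
    IsPreconnected (thickening Ω) := by
  refine (hΩ.prod isPreconnected_Ioo).image _ (Continuous.continuousOn ?_)
  refine continuous_halfSpacePt.comp (continuous_fst.prodMk (continuous_snd.mul ?_))
  exact (Metric.continuous_infDist_pt _).comp continuous_fst

theorem halfSpacePt_mem_thickening {Ω : Set ℂ} (hne : Ωᶜ.Nonempty) {w : ℂ} {t r : ℝ}
    (ht : 0 < t) (htr : t < r) (hr : Metric.ball w r ⊆ Ω) : halfSpacePt w t ∈ thickening Ω := by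
  have hle : r ≤ Metric.infDist w Ωᶜ := by
    refine (Metric.le_infDist hne).2 fun y hy => ?_
    by_contra! h
    exact hy (hr (by rwa [Metric.mem_ball, dist_comm]))
  have hpos : 0 < Metric.infDist w Ωᶜ := by linarith
  refine ⟨(w, t / Metric.infDist w Ωᶜ), ⟨hr (Metric.mem_ball_self (by linarith)), by positivity,
    (div_lt_one hpos).2 (by linarith)⟩, ?_⟩
  simp only [div_mul_cancel₀ _ hpos.ne']

theorem infDist_compl_pos {Ω : Set ℂ} (hΩ : IsOpen Ω) (hne : Ωᶜ.Nonempty) {z : ℂ} (hz : z ∈ Ω) :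
    0 < Metric.infDist z Ωᶜ :=
  (hΩ.isClosed_compl.notMem_iff_infDist_pos hne).1 fun h => h hz

theorem thickening_subset {C : Set CP1} (hC : IsClosed C) (hnt : C.Nontrivial) {Ω : Set ℂ}
    (hΩ : IsOpen Ω) (hne : Ωᶜ.Nonempty) (hd : ∀ z ∈ Ω, (z : CP1) ∉ C) :
    thickening Ω ⊆ H3 \ hull C := by
  rintro _ ⟨⟨z, s⟩, ⟨hz, hs⟩, rfl⟩
  have hpos := infDist_compl_pos hΩ hne hz
  have h1 : 0 < s * Metric.infDist z Ωᶜ := mul_pos hs.1 hpos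
  refine ⟨halfSpacePt_mem_H3 _ h1, halfSpacePt_notMem_hull hC hnt h1
    (mul_lt_of_lt_one_left hpos hs.2) fun c hc => ?_⟩
  rw [← dist_eq_norm, dist_comm]
  exact Metric.infDist_le_dist_of_mem fun h => hd c h hc

/-- Each side of the hull contains the thickening of one of the two regions cut out by `C`. -/
theorem exists_thickening_subset {C : Set CP1} (hC : IsClosed C) (hnt : C.Nontrivial)
    {Ω : Bool → Set ℂ} (hΩ : ∀ i, IsOpen (Ω i)) (hΩc : ∀ i, IsPreconnected (Ω i))
    (hne : ∀ i, (Ω i)ᶜ.Nonempty) (hd : ∀ i, ∀ z ∈ Ω i, (z : CP1) ∉ C)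
    (hcover : ∀ z : ℂ, (z : CP1) ∉ C → ∃ i, z ∈ Ω i) {U : Set E3} (hU : IsSide C U) :
    ∃ i, thickening (Ω i) ⊆ U := by
  obtain ⟨p, hp, rfl⟩ := hU
  obtain ⟨n, d, hn, hdp⟩ := exists_separating_of_notMem_hull hp
  set W : Set E3 := H3 ∩ {y | d < inner ℝ n y} with hW
  have hWconv : Convex ℝ W :=
    (convex_ball _ _).inter (convex_halfSpace_gt (innerSL ℝ n).toLinearMap.isLinear d)
  have hWsub : W ⊆ H3 \ hull C := fun y hy =>
    ⟨hy.1, fun h => not_lt.2 (inner_le_of_mem_hull hC hnt (fun c hc => (hn c hc).le) h) hy.2⟩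
  have hWU := hWconv.isPreconnected.subset_connectedComponentIn ⟨hp.1, hdp⟩ hWsub
  -- The ideal point in the direction of the normal vector lies in the ideal disk of `W`.
  have hn0 : n ≠ 0 := by
    rintro rfl
    obtain ⟨c, hc⟩ := hnt.nonempty
    have := hn c hc
    rw [inner_zero_left] at this hdp
    linarith
  have hnn : 0 < ‖n‖ := norm_pos_iff.2 hn0
  obtain ⟨ω, hω⟩ := exists_eq_toSphere (x := ‖n‖⁻¹ • n) (by
    rw [norm_smul, norm_inv, norm_norm, inv_mul_cancel₀ hnn.ne'])
  have hωd : d < inner ℝ n (toSphere ω) := by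
    rw [← hω, inner_smul_right, real_inner_self_eq_norm_sq, sq, inv_mul_cancel_left₀ hnn.ne']
    have h1 := real_inner_le_norm n p
    have h2 : ‖p‖ < 1 := mem_ball_zero_iff.1 hp.1
    nlinarith
  have hopen : IsOpen {ζ : CP1 | d < inner ℝ n (toSphere ζ)} :=
    isOpen_lt continuous_const (continuous_const.inner continuous_toSphere)
  obtain ⟨_, hw, w, rfl⟩ := OnePoint.denseRange_coe.inter_open_nonempty _ hopen ⟨ω, hωd⟩
  obtain ⟨i, hi⟩ := hcover w fun h => (lt_asymm (hn _ h) hw)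
  refine ⟨i, ?_⟩
  have hpos := infDist_compl_pos (hΩ i) (hne i) hi
  have hcont : Continuous fun s : ℝ =>
      inner ℝ n (halfSpacePt w (s * Metric.infDist w (Ω i)ᶜ)) :=
    continuous_const.inner (continuous_halfSpacePt.comp (by fun_prop :
      Continuous fun s : ℝ => (w, s * Metric.infDist w (Ω i)ᶜ)))
  have hev : ∀ᶠ s in 𝓝[>] (0 : ℝ), d < inner ℝ n (halfSpacePt w (s * Metric.infDist w (Ω i)ᶜ)) := by
    refine (hcont.continuousAt.eventually (isOpen_Ioi.mem_nhds ?_)).filter_mono nhdsWithin_le_nhds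
    simp only [zero_mul, ← toSphere_coe]
    exact hw
  obtain ⟨s, hs1, hs⟩ := (hev.and (Ioo_mem_nhdsGT (zero_lt_one' ℝ))).exists
  have hq : halfSpacePt w (s * Metric.infDist w (Ω i)ᶜ) ∈ thickening (Ω i) :=
    ⟨(w, s), ⟨hi, hs⟩, rfl⟩
  have hqW : halfSpacePt w (s * Metric.infDist w (Ω i)ᶜ) ∈ W :=
    ⟨halfSpacePt_mem_H3 _ (mul_pos hs.1 hpos), hs1⟩
  rw [connectedComponentIn_eq (hWU hqW)]
  exact (isPreconnected_thickening (hΩc i)).subset_connectedComponentIn hq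
    (thickening_subset hC hnt (hΩ i) (hne i) (hd i))

theorem exists_mem_frontier_of_isPreconnected {X : Type*} [TopologicalSpace X] {T U : Set X}
    (hT : IsPreconnected T) (h1 : (T ∩ U).Nonempty) (h2 : (T ∩ Uᶜ).Nonempty) :
    ∃ y ∈ T, y ∈ frontier U := by
  by_contra! h
  obtain ⟨a, haT, haU⟩ := h1
  obtain ⟨b, hbT, hbU⟩ := h2
  have hcov : T ⊆ interior U ∪ (closure U)ᶜ := fun y hy => by
    by_contra! hn
    simp only [mem_union, not_or, mem_compl_iff, not_not] at hn
    exact h y hy ⟨hn.2, hn.1⟩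
  obtain ⟨y, -, hy1, hy2⟩ := hT _ _ isOpen_interior isClosed_closure.isOpen_compl hcov
    ⟨a, haT, (hcov haT).resolve_right fun h => h (subset_closure haU)⟩
    ⟨b, hbT, (hcov hbT).resolve_left fun h => hbU (interior_subset h)⟩
  exact hy2 (subset_closure (interior_subset hy1))

/-- The two-sided corkscrew condition bounds the width: seen from a point of the hull, both regions
contain disks of definite size, and a straight path in half-space coordinates from the point to the
half-space over such a disk stays within bounded distance and crosses the frontier of the side. -/
theorem width_le {C : Set CP1} (hC : IsClosed C) (hnt : C.Nontrivial)
    {Ω : Bool → Set ℂ} (hΩ : ∀ i, IsOpen (Ω i)) (hΩc : ∀ i, IsPreconnected (Ω i))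
    (hne : ∀ i, (Ω i)ᶜ.Nonempty) (hd : ∀ i, ∀ z ∈ Ω i, (z : CP1) ∉ C)
    (hcover : ∀ z : ℂ, (z : CP1) ∉ C → ∃ i, z ∈ Ω i) {A δ : ℝ} (hδ : 0 < δ) (hδ2 : δ ≤ 2)
    (hA : 0 ≤ A)
    (hcork : ∀ i, ∀ c : ℂ, (c : CP1) ∈ C → ∀ t : ℝ, 0 < t →
      ∃ w : ℂ, ‖w - c‖ ≤ A * t ∧ Metric.ball w (δ * t) ⊆ Ω i) :
    width C ≤ ENNReal.ofReal (Real.arcosh (((A + 2) ^ 2 + 2) / δ)) +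
      ENNReal.ofReal (Real.arcosh (((A + 2) ^ 2 + 2) / δ)) := by
  have key : ∀ x ∈ hull C, ∀ U, IsSide C U →
      hypInfDist x (hypFrontier U) ≤ ENNReal.ofReal (Real.arcosh (((A + 2) ^ 2 + 2) / δ)) := by
    intro x hx U hU
    obtain ⟨i, hi⟩ := exists_thickening_subset hC hnt hΩ hΩc hne hd hcover hU
    obtain ⟨z, t, ht, rfl⟩ := exists_eq_halfSpacePt hx.1
    obtain ⟨c, hc, hct⟩ : ∃ c : ℂ, (c : CP1) ∈ C ∧ ‖c - z‖ < 2 * t := by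
      by_contra! h
      exact halfSpacePt_notMem_hull hC hnt ht (by linarith) h hx
    obtain ⟨w, hw, hball⟩ := hcork i c hc t ht
    have hwz : ‖w - z‖ ≤ (A + 2) * t := by
      calc ‖w - z‖ = ‖(w - c) + (c - z)‖ := by ring_nf
        _ ≤ ‖w - c‖ + ‖c - z‖ := norm_add_le _ _
        _ ≤ _ := by linarith
    have hs : 0 < δ * t / 2 := by positivity
    have hq : halfSpacePt w (δ * t / 2) ∈ U :=
      hi (halfSpacePt_mem_thickening (hne i) hs (by linarith) hball)
    have hxU : halfSpacePt z t ∉ U := by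
      obtain ⟨p, hp, rfl⟩ := hU
      exact fun h => (connectedComponentIn_subset _ _ h).2 hx
    set T : Set E3 := (fun s : ℝ => halfSpacePt (z + s * (w - z)) (t + s * (δ * t / 2 - t))) ''
      Icc 0 1 with hT
    have hTc : IsPreconnected T := by
      refine isPreconnected_Icc.image _ (Continuous.continuousOn ?_)
      exact continuous_halfSpacePt.comp (by fun_prop :
        Continuous fun s : ℝ => (z + s * (w - z), t + s * (δ * t / 2 - t)))
    have hT0 : halfSpacePt z t ∈ T := ⟨0, by simp, by simp⟩
    have hT1 : halfSpacePt w (δ * t / 2) ∈ T := ⟨1, by simp, by simp⟩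
    obtain ⟨_, ⟨s, hs01, rfl⟩, hfr⟩ :=
      exists_mem_frontier_of_isPreconnected hTc ⟨_, hT1, hq⟩ ⟨_, hT0, hxU⟩
    have hδt : δ * t / 2 ≤ t := by nlinarith
    have hts : δ * t / 2 ≤ t + s * (δ * t / 2 - t) := by nlinarith [hs01.1, hs01.2]
    have hts' : t + s * (δ * t / 2 - t) ≤ t := by nlinarith [hs01.1, hs01.2]
    set τ := t + s * (δ * t / 2 - t) with hτ
    have hτ0 : 0 < τ := hs.trans_le hts
    have hmem : halfSpacePt (z + s * (w - z)) τ ∈ hypFrontier U := ⟨hfr, halfSpacePt_mem_H3 _ hτ0⟩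
    refine (iInf₂_le _ hmem).trans ?_
    refine ENNReal.ofReal_le_ofReal ?_
    rw [hypDist_halfSpacePt _ _ ht hτ0, Real.arcosh_le_arcosh (by positivity) (by positivity)]
    have hz : ‖z - (z + s * (w - z))‖ ≤ (A + 2) * t := by
      rw [sub_add_cancel_left, norm_neg, norm_mul, Complex.norm_real, Real.norm_of_nonneg hs01.1]
      nlinarith [norm_nonneg (w - z), hs01.1, hs01.2]
    have hz2 : ‖z - (z + s * (w - z))‖ ^ 2 ≤ ((A + 2) * t) ^ 2 :=
      pow_le_pow_left₀ (norm_nonneg _) hz 2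
    rw [div_le_div_iff₀ (by positivity) hδ]
    have h4 : τ ^ 2 ≤ t ^ 2 := pow_le_pow_left₀ hτ0.le hts' 2
    have h5 : 0 ≤ (A + 2) ^ 2 + 2 := by positivity
    calc (‖z - (z + s * (w - z))‖ ^ 2 + t ^ 2 + τ ^ 2) * δ
        ≤ (((A + 2) * t) ^ 2 + t ^ 2 + t ^ 2) * δ := by gcongr
      _ = ((A + 2) ^ 2 + 2) * (2 * t * (δ * t / 2)) := by ring
      _ ≤ ((A + 2) ^ 2 + 2) * (2 * t * τ) := by gcongr
  rw [width]
  refine iSup₂_le fun x hx => iSup₂_le fun U V => iSup₂_le fun hU hV => iSup_le fun _ => ?_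
  exact add_le_add (key x hx U hU) (key x hx V hV)

/-! ### Reflection in a quasicircle -/

/-- Complex conjugation on `CP1`. -/
def conjCP1 : CP1 ≃ₜ CP1 := Complex.conjLIE.toHomeomorph.onePointCongr

theorem conjCP1_coe (z : ℂ) : conjCP1 (z : CP1) = ((starRingEnd ℂ z : ℂ) : CP1) := rfl

theorem conjCP1_conjCP1 (z : CP1) : conjCP1 (conjCP1 z) = z := by
  induction z using OnePoint.rec with
  | infty => rfl
  | coe z => simp [conjCP1_coe]

theorem mem_RP1_coe (z : ℂ) : (z : CP1) ∈ RP1 ↔ z.im = 0 := by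
  constructor
  · rintro (h | ⟨t, ht⟩)
    · exact absurd h (OnePoint.coe_ne_infty z)
    · rw [← OnePoint.coe_injective ht, Complex.ofReal_im]
  · intro h
    exact Or.inr ⟨z.re, congrArg _ (Complex.ext rfl h.symm)⟩

theorem conjCP1_of_mem_RP1 {z : CP1} (hz : z ∈ RP1) : conjCP1 z = z := by
  obtain rfl | ⟨t, rfl⟩ := hz
  · rfl
  · simp [conjCP1_coe]

/-- A preconnected subset of the complement of `RP1` does not contain two conjugate points. -/
theorem conjCP1_notMem_of_isPreconnected {S : Set CP1} (hS : IsPreconnected S)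
    (hd : Disjoint S RP1) {z : CP1} (hz : z ∈ S) : conjCP1 z ∉ S := by
  intro hz'
  have hopen : ∀ {u : Set ℂ}, IsOpen u → IsOpen (((↑) : ℂ → CP1) '' u) := fun h =>
    OnePoint.isOpen_image_coe.2 h
  have hpos : IsOpen (((↑) : ℂ → CP1) '' {z | 0 < z.im}) :=
    hopen (isOpen_lt continuous_const Complex.continuous_im)
  have hneg : IsOpen (((↑) : ℂ → CP1) '' {z | z.im < 0}) :=
    hopen (isOpen_lt Complex.continuous_im continuous_const)
  have hcov : S ⊆ ((↑) : ℂ → CP1) '' {z | 0 < z.im} ∪ ((↑) : ℂ → CP1) '' {z | z.im < 0} := by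
    intro w hw
    have hwR : w ∉ RP1 := fun h => disjoint_left.1 hd hw h
    induction w using OnePoint.rec with
    | infty => exact absurd (Or.inl rfl) hwR
    | coe w =>
      rw [mem_RP1_coe] at hwR
      rcases lt_or_gt_of_ne hwR with h | h
      · exact Or.inr ⟨w, h, rfl⟩
      · exact Or.inl ⟨w, h, rfl⟩
  have hzz : (S ∩ ((↑) : ℂ → CP1) '' {z | 0 < z.im}).Nonempty ∧
      (S ∩ ((↑) : ℂ → CP1) '' {z | z.im < 0}).Nonempty := by
    rcases hcov hz with ⟨w, hw, rfl⟩ | ⟨w, hw, rfl⟩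
    · refine ⟨⟨_, hz, w, hw, rfl⟩, ⟨_, hz', starRingEnd ℂ w, ?_, rfl⟩⟩
      simpa using hw
    · refine ⟨⟨_, hz', starRingEnd ℂ w, ?_, rfl⟩, ⟨_, hz, w, hw, rfl⟩⟩
      simpa using hw
  obtain ⟨y, -, ⟨a, ha, rfl⟩, ⟨b, hb, hab⟩⟩ := hS _ _ hpos hneg hcov hzz.1 hzz.2
  rw [OnePoint.coe_injective hab] at hb
  have ha' : 0 < a.im := ha
  have hb' : a.im < 0 := hb
  linarith

theorem imageFamily_imageFamily (f g : CP1 ≃ₜ CP1) (Γ : Set C(I, CP1)) :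
    imageFamily f (imageFamily g Γ) = imageFamily (g.trans f) Γ := by
  rw [imageFamily, imageFamily, imageFamily, image_image]
  rfl

theorem imageFamily_eq_self {f : CP1 ≃ₜ CP1} (hf : ∀ z, f z = z) (Γ : Set C(I, CP1)) :
    imageFamily f Γ = Γ := by
  rw [imageFamily]
  convert image_id Γ using 2 with γ
  ext1 t
  exact hf (γ t)

theorem modulus_imageFamily_conjCP1 (Γ : Set C(I, CP1)) :
    modulus Γ ≤ modulus (imageFamily conjCP1 Γ) := by
  have h := modulus_imageFamily_onePointCongr_le Complex.conjLIE.toHomeomorph (L := 1) one_ne_zero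
    Complex.conjLIE.lipschitz Complex.conjLIE.symm.lipschitz (imageFamily conjCP1 Γ)
  have h2 : imageFamily Complex.conjLIE.toHomeomorph.onePointCongr (imageFamily conjCP1 Γ) = Γ :=
    (imageFamily_imageFamily conjCP1 conjCP1 Γ).trans (imageFamily_eq_self conjCP1_conjCP1 Γ)
  simpa [h2] using h

/-- The reflection in a `K`-quasicircle: a homeomorphism that fixes the curve, moves each connected
subset of the complement off itself, and distorts moduli by at most `K ^ 2`. -/
theorem exists_reflection {K : ℝ} {C : Set CP1} (h : IsQuasicircle K C) :
    ∃ J : CP1 ≃ₜ CP1, (∀ z ∈ C, J z = z) ∧ (∀ z ∉ C, J z ∉ C) ∧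
      (∀ S : Set CP1, IsPreconnected S → Disjoint S C → ∀ z ∈ S, J z ∉ S) ∧
      ∀ Γ : Set C(I, CP1), (∀ γ ∈ Γ, ∃ s t, γ s ≠ γ t) →
        modulus Γ ≤ ENNReal.ofReal K ^ 2 * modulus (imageFamily J Γ) := by
  obtain ⟨-, f, hf, rfl⟩ := h
  have hmem : ∀ z, z ∈ f '' RP1 ↔ f.symm z ∈ RP1 := fun z => by
    rw [f.image_eq_preimage_symm]; rfl
  refine ⟨f.symm.trans (conjCP1.trans f), fun z hz => ?_, fun z hz => ?_,
    fun S hS hd z hz hz' => ?_, fun Γ hΓ => ?_⟩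
  · simp only [Homeomorph.trans_apply]
    rw [conjCP1_of_mem_RP1 ((hmem z).1 hz), f.apply_symm_apply]
  · rw [hmem] at hz ⊢
    simp only [Homeomorph.trans_apply, f.symm_apply_apply]
    intro h
    have := conjCP1_of_mem_RP1 h
    rw [conjCP1_conjCP1] at this
    exact hz (this ▸ h)
  · refine conjCP1_notMem_of_isPreconnected (S := f.symm '' S)
      (hS.image _ f.symm.continuous.continuousOn) ?_ ⟨z, hz, rfl⟩ ⟨_, hz', ?_⟩
    · rw [disjoint_left]
      rintro _ ⟨w, hw, rfl⟩ hwR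
      exact disjoint_left.1 hd hw ((hmem w).2 hwR)
    · simp [Homeomorph.trans_apply]
  · set Γ₀ := imageFamily f.symm Γ with hΓ₀
    have h0 : imageFamily f Γ₀ = Γ :=
      (imageFamily_imageFamily f f.symm Γ).trans (imageFamily_eq_self (fun z => by simp) Γ)
    have hJ : imageFamily f (imageFamily conjCP1 Γ₀) =
        imageFamily (f.symm.trans (conjCP1.trans f)) Γ := by
      rw [hΓ₀, imageFamily_imageFamily, imageFamily_imageFamily]
    have hn0 : ∀ γ ∈ Γ₀, ∃ s t, γ s ≠ γ t := by
      rintro _ ⟨γ, hγ, rfl⟩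
      obtain ⟨s, t, hst⟩ := hΓ γ hγ
      exact ⟨s, t, fun h => hst (f.symm.injective h)⟩
    have hn1 : ∀ γ ∈ imageFamily conjCP1 Γ₀, ∃ s t, γ s ≠ γ t := by
      rintro _ ⟨γ, hγ, rfl⟩
      obtain ⟨s, t, hst⟩ := hn0 γ hγ
      exact ⟨s, t, fun h => hst (conjCP1.injective h)⟩
    calc modulus Γ = modulus (imageFamily f Γ₀) := by rw [h0]
      _ ≤ ENNReal.ofReal K * modulus Γ₀ := (hf.2 Γ₀ hn0).1
      _ ≤ ENNReal.ofReal K * modulus (imageFamily conjCP1 Γ₀) := by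
        gcongr
        exact modulus_imageFamily_conjCP1 Γ₀
      _ ≤ ENNReal.ofReal K *
          (ENNReal.ofReal K * modulus (imageFamily f (imageFamily conjCP1 Γ₀))) := by
        gcongr
        exact (hf.2 _ hn1).2
      _ = _ := by rw [hJ, sq, mul_assoc]

/-! ### Estimates of moduli -/

/-- Paths of diameter at least one that start near the origin form a family of bounded modulus. -/
theorem modulus_le_of_one_le_dist {Γ : Set C(I, CP1)}
    (hΓ : ∀ c : C(I, ℂ), toCP1 c ∈ Γ → ‖c 0‖ ≤ 1 ∧ ∃ t, 1 ≤ dist (c 0) (c t)) :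
    modulus Γ ≤ volume (Metric.closedBall (0 : ℂ) 2) := by
  have hadm : IsAdmissible Γ ((Metric.closedBall (0 : ℂ) 2).indicator 1) := by
    refine ⟨measurable_one.indicator Metric.isClosed_closedBall.measurableSet, fun c hc hlen => ?_⟩
    obtain ⟨h0, t, ht⟩ := hΓ c hc
    have hlen' : eVariationOn c univ ≠ ∞ := hlen
    have h1 : 1 ≤ (eVariationOn c univ).toReal := by
      have h2 := dist_le_abs_arcLen_sub hlen' 0 t
      rw [arcLen_zero, zero_sub, abs_neg] at h2
      have h3 : arcLen c t ∈ Icc 0 (eVariationOn c univ).toReal := by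
        rw [← range_arcLen hlen']; exact mem_range_self t
      rw [abs_of_nonneg h3.1] at h2
      linarith [h3.2]
    have hsub : Icc (0 : ℝ) 1 ⊆ Icc 0 (pathLength c).toReal := Icc_subset_Icc_right h1
    calc (1 : ℝ≥0∞) = ∫⁻ _ in Icc (0 : ℝ) 1, 1 := by simp
      _ ≤ ∫⁻ s in Icc (0 : ℝ) 1, (Metric.closedBall (0 : ℂ) 2).indicator 1
            (naturalParameterization c univ 0 s) := by
          refine setLIntegral_mono' measurableSet_Icc fun s hs => ?_
          have hlip := (lipschitzOnWith_naturalParameterization hlen').dist_le_mul s (hsub hs) 0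
            (hsub ⟨le_rfl, zero_le_one⟩)
          have hn0 : naturalParameterization c univ 0 0 = c 0 := by
            simpa [arcLen_zero] using naturalParameterization_arcLen hlen' 0
          rw [hn0, NNReal.coe_one, one_mul, Real.dist_eq, sub_zero, abs_of_nonneg hs.1] at hlip
          rw [indicator_of_mem]
          · rfl
          · rw [Metric.mem_closedBall]
            refine (dist_triangle _ (c 0) _).trans ?_
            rw [dist_zero_right]
            linarith [hs.2]
      _ ≤ lineIntegral _ c := lintegral_mono_set hsub
  refine (iInf₂_le _ hadm).trans_eq ?_
  rw [← lintegral_indicator_one Metric.isClosed_closedBall.measurableSet]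
  congr 1
  ext z
  by_cases hz : z ∈ Metric.closedBall (0 : ℂ) 2 <;> simp [hz]

/-- The vertical segment that goes up from `x + i y` by the height `ℓ`. -/
def verticalPath (x y ℓ : ℝ) : C(I, ℂ) :=
  ⟨fun t => ⟨x, y + ℓ * t⟩, by
    have : (fun t : I => (⟨x, y + ℓ * t⟩ : ℂ)) =
        fun t : I => (x : ℂ) + (y + ℓ * t : ℝ) * Complex.I :=
      funext fun t => by rw [Complex.mk_eq_add_mul_I]
    rw [this]
    fun_prop⟩

theorem eVariationOn_scaled (ℓ : ℝ) (hℓ : 0 ≤ ℓ) (a b : I) (hab : a ≤ b) :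
    eVariationOn (fun t : I => ℓ * (t : ℝ)) (Icc a b) = ENNReal.ofReal (ℓ * b - ℓ * a) := by
  have hm : MonotoneOn (fun t : I => ℓ * (t : ℝ)) (Icc a b) := fun s _ t _ hst =>
    mul_le_mul_of_nonneg_left hst hℓ
  have := hm.eVariationOn_eq (a := a) (b := b) ⟨le_rfl, hab⟩ ⟨hab, le_rfl⟩
  rwa [inter_self] at this

theorem pathLength_ne_top_and_lineIntegral_verticalPath_le (x y : ℝ) {ℓ : ℝ} (hℓ : 0 ≤ ℓ) :
    pathLength (verticalPath x y ℓ) ≠ ∞ ∧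
    ∀ {ρ : ℂ → ℝ≥0∞}, Measurable ρ →
      lineIntegral ρ (verticalPath x y ℓ) ≤ ∫⁻ s in Icc 0 ℓ, ρ ⟨x, y + s⟩ := by
  set c' : C(I, ℝ) := ⟨fun t => ℓ * t, by fun_prop⟩ with hc'
  have huniv : (univ : Set I) = Icc 0 1 := by
    ext t; simp [unitInterval.le_one']
  have hlen : eVariationOn c' univ = ENNReal.ofReal ℓ := by
    rw [huniv]
    simpa using! eVariationOn_scaled ℓ hℓ 0 1 zero_le_one
  have hlip : LipschitzWith 1 fun s : ℝ => (⟨x, y + s⟩ : ℂ) :=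
    LipschitzWith.of_dist_le_mul fun s t => by
      rw [Complex.dist_of_re_eq (z := ⟨x, y + s⟩) (w := ⟨x, y + t⟩) rfl]
      simp
  have hle : ∀ s, eVariationOn (verticalPath x y ℓ) s ≤ (1 : NNReal) * eVariationOn c' s := fun s =>
    hlip.lipschitzOnWith.comp_eVariationOn_le (mapsTo_univ _ _)
  have htop : eVariationOn (verticalPath x y ℓ) univ ≠ ∞ := by
    refine ne_top_of_le_ne_top ?_ (hle univ)
    rw [hlen]
    finiteness
  have htop' : eVariationOn c' univ ≠ ∞ := by rw [hlen]; finiteness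
  refine ⟨htop, fun {ρ} hρ => ?_⟩
  refine (lintegral_naturalParameterization_le (c' := c') (L := 1) htop htop' (fun a b => hle _) hρ
    (G' := fun s => ρ ⟨x, y + s⟩) fun t => rfl).trans_eq ?_
  rw [hlen, ENNReal.toReal_ofReal hℓ, ENNReal.coe_one, one_mul]
  refine setLIntegral_congr_fun measurableSet_Icc fun s hs => ?_
  have hs' : s ∈ Icc 0 (eVariationOn c' univ).toReal := by
    rwa [hlen, ENNReal.toReal_ofReal hℓ]
  have h1 := arcLen_arcInv htop' hs'
  have h2 := arcLen_sub htop' (unitInterval.nonneg' (t := arcInv c' s))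
  have h3 := eVariationOn_scaled ℓ hℓ 0 (arcInv c' s) unitInterval.nonneg'
  have h4 : arcLen c' (arcInv c' s) = c' (arcInv c' s) := by
    have h5 : 0 ≤ ℓ * (arcInv c' s : ℝ) := mul_nonneg hℓ unitInterval.nonneg'
    rw [arcLen_zero, sub_zero] at h2
    rw [h2]
    change (eVariationOn (fun t : I => ℓ * (t : ℝ)) (Icc 0 (arcInv c' s))).toReal = _
    rw [h3]
    rw [Icc.coe_zero, mul_zero, sub_zero, ENNReal.toReal_ofReal h5]
    rfl
  simp only [naturalParameterization_eq, ← h4, h1]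

/-- A length-area lower bound for the modulus of a family of vertical segments. -/
theorem lintegral_inv_le_modulus {Γ : Set C(I, CP1)} {S : Set ℝ} (hS : MeasurableSet S)
    {y ℓ : ℝ → ℝ} (hℓ : ∀ x ∈ S, 0 < ℓ x)
    (hΓ : ∀ x ∈ S, toCP1 (verticalPath x (y x) (ℓ x)) ∈ Γ) :
    ∫⁻ x in S, ENNReal.ofReal (ℓ x)⁻¹ ≤ modulus Γ := by
  refine le_iInf₂ fun ρ hρ => ?_
  have hfub : ∫⁻ z, ρ z ^ 2 = ∫⁻ x : ℝ, ∫⁻ s : ℝ, ρ ⟨x, s⟩ ^ 2 := by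
    rw [← Complex.volume_preserving_equiv_real_prod.symm.lintegral_comp (hρ.1.pow_const 2)]
    rw [Measure.volume_eq_prod, lintegral_prod]
    · rfl
    · exact ((hρ.1.pow_const 2).comp Complex.measurableEquivRealProd.symm.measurable).aemeasurable
  rw [hfub]
  refine le_trans ?_ (setLIntegral_le_lintegral S _)
  refine setLIntegral_mono' hS fun x hx => ?_
  have hpos := hℓ x hx
  obtain ⟨hlen, hline⟩ := pathLength_ne_top_and_lineIntegral_verticalPath_le x (y x) hpos.le
  have h1 : 1 ≤ ∫⁻ s in Icc 0 (ℓ x), ρ ⟨x, y x + s⟩ := (hρ.2 _ (hΓ x hx) hlen).trans (hline hρ.1)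
  set b := ENNReal.ofReal (ℓ x) with hb
  set a := ENNReal.ofReal (ℓ x)⁻¹ with ha
  have hab : a * b = 1 := by
    rw [ha, hb, ← ENNReal.ofReal_mul (by positivity), inv_mul_cancel₀ hpos.ne', ENNReal.ofReal_one]
  have hmeas : Measurable fun s : ℝ => ρ ⟨x, y x + s⟩ := by
    refine hρ.1.comp (Continuous.measurable ?_)
    have : (fun s : ℝ => (⟨x, y x + s⟩ : ℂ)) = fun s : ℝ => (x : ℂ) + (y x + s : ℝ) * Complex.I :=
      funext fun t => by rw [Complex.mk_eq_add_mul_I]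
    rw [this]
    fun_prop
  -- Integrate `2 ρ ≤ ℓ ρ² + ℓ⁻¹` over the segment.
  have hpt : ∀ r : ℝ≥0∞, 2 * r ≤ b * r ^ 2 + a := by
    intro r
    rcases eq_or_ne r ∞ with rfl | hr
    · simp [hb, hpos]
    · lift r to NNReal using hr
      rw [← ENNReal.ofReal_coe_nnreal, ← ENNReal.ofReal_pow r.coe_nonneg, hb, ha,
        ← ENNReal.ofReal_mul hpos.le, ← ENNReal.ofReal_add (by positivity) (by positivity),
        ← ENNReal.ofReal_ofNat, ← ENNReal.ofReal_mul (by norm_num)]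
      refine ENNReal.ofReal_le_ofReal ?_
      have h3 : ℓ x * (ℓ x)⁻¹ = 1 := mul_inv_cancel₀ hpos.ne'
      have h4 : 0 ≤ (ℓ x)⁻¹ * (ℓ x * r - 1) ^ 2 := by positivity
      have h5 : (ℓ x)⁻¹ * (ℓ x * r - 1) ^ 2 =
        (ℓ x * (ℓ x)⁻¹) * (ℓ x * r ^ 2) - (ℓ x * (ℓ x)⁻¹) * 2 * r + (ℓ x)⁻¹ := by ring
      rw [h5, h3] at h4
      linarith
  have h2 : (2 : ℝ≥0∞) ≤ b * (∫⁻ s in Icc 0 (ℓ x), ρ ⟨x, y x + s⟩ ^ 2) + 1 := by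
    calc (2 : ℝ≥0∞) ≤ 2 * ∫⁻ s in Icc 0 (ℓ x), ρ ⟨x, y x + s⟩ := by
          simpa using mul_le_mul_right h1 2
      _ = ∫⁻ s in Icc 0 (ℓ x), 2 * ρ ⟨x, y x + s⟩ := (lintegral_const_mul _ hmeas).symm
      _ ≤ ∫⁻ s in Icc 0 (ℓ x), (b * ρ ⟨x, y x + s⟩ ^ 2 + a) := lintegral_mono fun s => hpt _
      _ = b * (∫⁻ s in Icc 0 (ℓ x), ρ ⟨x, y x + s⟩ ^ 2) + 1 := by
          rw [lintegral_add_right _ measurable_const, lintegral_const_mul _ (hmeas.pow_const 2)]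
          simp [← hb, hab]
  have h3 : (1 : ℝ≥0∞) ≤ b * ∫⁻ s in Icc 0 (ℓ x), ρ ⟨x, y x + s⟩ ^ 2 := by
    rw [← one_add_one_eq_two] at h2
    exact (ENNReal.add_le_add_iff_right ENNReal.one_ne_top).1 h2
  calc a ≤ a * (b * ∫⁻ s in Icc 0 (ℓ x), ρ ⟨x, y x + s⟩ ^ 2) := by
        simpa using mul_le_mul_right h3 a
    _ = ∫⁻ s in Icc 0 (ℓ x), ρ ⟨x, y x + s⟩ ^ 2 := by rw [← mul_assoc, hab, one_mul]
    _ ≤ ∫⁻ s : ℝ, ρ ⟨x, y x + s⟩ ^ 2 := setLIntegral_le_lintegral _ _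
    _ = ∫⁻ s : ℝ, ρ ⟨x, s⟩ ^ 2 := lintegral_add_left_eq_self (fun s : ℝ => ρ ⟨x, s⟩ ^ 2) (y x)

/-! ### Jordan curves and circular arcs -/

theorem continuous_onePointMap_ofReal :
    Continuous (OnePoint.map (fun t : ℝ => (t : ℂ)) : OnePoint ℝ → CP1) := by
  refine OnePoint.continuous_map Complex.continuous_ofReal ?_
  rw [coclosedCompact_eq_cocompact, coclosedCompact_eq_cocompact]
  exact Complex.isometry_ofReal.isClosedEmbedding.tendsto_cocompact

theorem isJordanCurve_RP1 : IsJordanCurve RP1 := by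
  let e : OnePoint ℝ ≃ₜ Metric.sphere (0 : EuclideanSpace ℝ (Fin 2)) 1 :=
    onePointEquivSphereOfFinrankEq (by simp)
  have hsph : ∀ z : Circle, Complex.orthonormalBasisOneI.repr (z : ℂ) ∈
      Metric.sphere (0 : EuclideanSpace ℝ (Fin 2)) 1 := fun z => by
    rw [mem_sphere_zero_iff_norm, LinearIsometryEquiv.norm_map, Circle.norm_coe]
  let φ : Circle → Metric.sphere (0 : EuclideanSpace ℝ (Fin 2)) 1 := fun z => ⟨_, hsph z⟩
  have hφ : Continuous φ :=
    (Complex.orthonormalBasisOneI.repr.continuous.comp continuous_subtype_val).subtype_mk _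
  have hφi : Function.Injective φ := fun z w h =>
    Circle.ext (Complex.orthonormalBasisOneI.repr.injective (congrArg Subtype.val h))
  have hφs : Function.Surjective φ := fun x => by
    refine ⟨⟨Complex.orthonormalBasisOneI.repr.symm x.1, ?_⟩, Subtype.ext ?_⟩
    · refine mem_sphere_zero_iff_norm.2 ?_
      rw [LinearIsometryEquiv.norm_map]
      exact mem_sphere_zero_iff_norm.1 x.2
    · exact Complex.orthonormalBasisOneI.repr.apply_symm_apply _
  have hmi : Function.Injective (OnePoint.map (fun t : ℝ => (t : ℂ)) : OnePoint ℝ → CP1) :=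
    Option.map_injective Complex.ofReal_injective
  refine ⟨fun z => OnePoint.map (fun t : ℝ => (t : ℂ)) (e.symm (φ z)),
    continuous_onePointMap_ofReal.comp (e.symm.continuous.comp hφ),
    hmi.comp (e.symm.injective.comp hφi), ?_⟩
  have : range (fun z => OnePoint.map (fun t : ℝ => (t : ℂ)) (e.symm (φ z))) =
      range (OnePoint.map (fun t : ℝ => (t : ℂ)) : OnePoint ℝ → CP1) :=
    (e.symm.surjective.comp hφs).range_comp _
  rw [this]
  ext w
  constructor
  · rintro ⟨t, rfl⟩
    induction t using OnePoint.rec with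
    | infty => exact Or.inl rfl
    | coe t => exact Or.inr ⟨t, rfl⟩
  · rintro (rfl | ⟨t, rfl⟩)
    · exact ⟨OnePoint.infty, rfl⟩
    · exact ⟨(t : OnePoint ℝ), rfl⟩

theorem IsJordanCurve.image {C : Set CP1} (h : IsJordanCurve C) (f : CP1 ≃ₜ CP1) :
    IsJordanCurve (f '' C) := by
  obtain ⟨g, hg, hgi, rfl⟩ := h
  exact ⟨f ∘ g, f.continuous.comp hg, f.injective.comp hgi, range_comp _ _⟩

theorem isPreconnected_compl_singleton_circle (z₀ : Circle) :
    IsPreconnected ({z₀}ᶜ : Set Circle) := by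
  have : ({z₀}ᶜ : Set Circle) = (fun t : ℝ => z₀ * Circle.exp t) '' Ioo 0 (2 * Real.pi) := by
    ext z
    constructor
    · intro hz
      have harg : Circle.exp (Complex.arg ((z₀⁻¹ * z : Circle) : ℂ)) = z₀⁻¹ * z := Circle.exp_arg _
      set θ := Complex.arg ((z₀⁻¹ * z : Circle) : ℂ) with hθ
      have h1 : -Real.pi < θ := Complex.neg_pi_lt_arg _
      have h2 : θ ≤ Real.pi := Complex.arg_le_pi _
      have hpi := Real.pi_pos
      have h0 : θ ≠ 0 := by
        intro h0
        rw [h0, Circle.exp_zero] at harg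
        exact hz (inv_mul_eq_one.1 harg.symm).symm
      rcases lt_or_gt_of_ne h0 with h | h
      · refine ⟨θ + 2 * Real.pi, ⟨by linarith, by linarith⟩, ?_⟩
        simp only [Circle.exp_add, Circle.exp_two_pi, mul_one, harg, mul_inv_cancel_left]
      · refine ⟨θ, ⟨h, by linarith⟩, ?_⟩
        simp only [harg, mul_inv_cancel_left]
    · rintro ⟨t, ht, rfl⟩ h
      have h1 : Circle.exp t = 1 := mul_eq_left.1 h
      rw [Circle.exp_eq_one] at h1
      obtain ⟨m, hm⟩ := h1
      have hpi := Real.pi_pos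
      have h2 : (0 : ℝ) < m := by
        by_contra! h
        nlinarith [ht.1]
      have h3 : (m : ℝ) < 1 := by
        by_contra! h
        nlinarith [ht.2]
      have h4 : 0 < m := by exact_mod_cast h2
      have h5 : m < 1 := by exact_mod_cast h3
      omega
  rw [this]
  exact isPreconnected_Ioo.image _ (by fun_prop)

/-- A Jordan curve has no cut points. -/
theorem IsJordanCurve.isPreconnected_diff_singleton {C : Set CP1} (h : IsJordanCurve C) {p : CP1}
    (hp : p ∈ C) : IsPreconnected (C \ {p}) := by
  obtain ⟨g, hg, hgi, rfl⟩ := h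
  obtain ⟨z₀, rfl⟩ := hp
  have : range g \ {g z₀} = g '' {z₀}ᶜ := by
    rw [image_compl_eq_range_sdiff_image hgi, image_singleton]
  rw [this]
  exact (isPreconnected_compl_singleton_circle z₀).image _ hg.continuousOn

/-- A Euclidean line together with `∞` is a circle. -/
theorem exists_isCircle_line (p v : ℂ) (hv : v ≠ 0) :
    ∃ S, IsCircle S ∧ OnePoint.infty ∈ S ∧ ∀ t : ℝ, ((p + t * v : ℂ) : CP1) ∈ S := by
  -- The plane through the north pole that projects to the line with normal vector `(-v.im, v.re)`.
  set c : ℝ := -v.im * p.re + v.re * p.im with hc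
  set n : E3 := !₂[-v.im, v.re, c] with hn
  refine ⟨_, ⟨n, c, ?_, rfl⟩, ?_, fun t => ?_⟩
  · have h1 : ‖n‖ ^ 2 = v.im ^ 2 + v.re ^ 2 + c ^ 2 := by
      rw [norm_sq_E3]
      simp [hn]
    have h2 : 0 < v.im ^ 2 + v.re ^ 2 := by
      have := norm_sq_C v
      have h3 : 0 < ‖v‖ ^ 2 := by positivity
      linarith
    refine abs_lt_of_sq_lt_sq ?_ (norm_nonneg _)
    linarith
  · simp [toSphere_infty, inner_E3, hn]
  · have h1 : ‖p + t * v‖ ^ 2 + 0 ^ 2 + 1 ≠ 0 := by positivity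
    change inner ℝ n (toSphere _) = c
    rw [toSphere_coe, inner_E3]
    simp only [halfSpacePt, hn, PiLp.toLp_apply, Matrix.cons_val]
    field_simp
    rw [hc]
    simp only [Complex.add_re, Complex.add_im, Complex.re_ofReal_mul, Complex.im_ofReal_mul]
    ring

theorem coe_add_mul_injective (p v : ℂ) (hv : v ≠ 0) :
    Function.Injective fun t : ℝ => ((p + t * v : ℂ) : CP1) := by
  intro s t h
  have h1 := OnePoint.coe_injective h
  have h2 := mul_right_cancel₀ hv (add_left_cancel h1)
  exact_mod_cast h2

/-- The segment from `p` to `p + v`. -/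
def segmentSet (p v : ℂ) : Set CP1 := (fun t : ℝ => ((p + t * v : ℂ) : CP1)) '' Icc 0 1

/-- The ray from `p` in the direction `v`, together with `∞`. -/
def raySet (p v : ℂ) : Set CP1 :=
  insert OnePoint.infty ((fun t : ℝ => ((p + t * v : ℂ) : CP1)) '' Ici 0)

theorem isCircularArc_segmentSet (p v : ℂ) (hv : v ≠ 0) : IsCircularArc (segmentSet p v) := by
  obtain ⟨S, hS, -, hS'⟩ := exists_isCircle_line p v hv
  refine ⟨S, hS, fun t => ((p + (t : ℝ) * v : ℂ) : CP1),
    OnePoint.continuous_coe.comp (by fun_prop),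
    (coe_add_mul_injective p v hv).comp Subtype.val_injective, ?_, ?_⟩
  · rw [segmentSet, image_eq_range]
  · rintro _ ⟨t, -, rfl⟩
    exact hS' t

theorem isCircularArc_raySet (p v : ℂ) (hv : v ≠ 0) : IsCircularArc (raySet p v) := by
  obtain ⟨S, hS, hSi, hS'⟩ := exists_isCircle_line p v hv
  -- The ray is parametrized by the inverse of the parameter, so that `∞` corresponds to `0`.
  set g₀ : ℝ → ℂ := fun t => p + ((t⁻¹ - 1 : ℝ) : ℂ) * v with hg₀
  set g : I → CP1 := fun t => if (t : ℝ) = 0 then OnePoint.infty else ((g₀ t : ℂ) : CP1) with hg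
  refine ⟨S, hS, g, ?_, ?_, ?_, ?_⟩
  · rw [continuous_iff_continuousAt]
    intro t
    by_cases ht : (t : ℝ) = 0
    · have ht' : g t = OnePoint.infty := if_pos ht
      rw [← continuousWithinAt_compl_self, ContinuousWithinAt, ht']
      have h1 : Tendsto (fun s : I => (s : ℝ)) (𝓝[≠] t) (𝓝[>] 0) := by
        refine tendsto_nhdsWithin_iff.2 ⟨?_, ?_⟩
        · rw [← ht]
          exact continuous_subtype_val.continuousAt.mono_left nhdsWithin_le_nhds
        · filter_upwards [self_mem_nhdsWithin] with s hs
          refine lt_of_le_of_ne s.2.1 fun h => hs (Subtype.ext ?_)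
          rw [← h, ht]
      have h2 : Tendsto (fun u : ℝ => p + ((u - 1 : ℝ) : ℂ) * v) atTop (cocompact ℂ) := by
        rw [← Metric.cobounded_eq_cocompact, ← tendsto_norm_atTop_iff_cobounded]
        have h3 : Tendsto (fun u : ℝ => (u - 1) * ‖v‖ - ‖p‖) atTop atTop := by
          refine tendsto_atTop_add_const_right _ _ (Tendsto.atTop_mul_const (norm_pos_iff.2 hv) ?_)
          exact tendsto_atTop_add_const_right _ _ tendsto_id
        refine tendsto_atTop_mono (fun u => ?_) h3
        have h4 := norm_sub_norm_le (((u - 1 : ℝ) : ℂ) * v) (-p)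
        rw [norm_mul, Complex.norm_real, norm_neg, sub_neg_eq_add, add_comm _ p] at h4
        refine le_trans ?_ h4
        gcongr
        exact le_abs_self _
      have h5 : Tendsto (fun s : I => ((g₀ s : ℂ) : CP1)) (𝓝[≠] t) (𝓝 OnePoint.infty) := by
        have h6 := OnePoint.tendsto_coe_infty (X := ℂ)
        rw [coclosedCompact_eq_cocompact] at h6
        exact h6.comp (h2.comp (tendsto_inv_nhdsGT_zero.comp h1))
      refine h5.congr' ?_
      filter_upwards [self_mem_nhdsWithin] with s hs
      refine (if_neg fun h => hs (Subtype.ext ?_)).symm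
      rw [h, ht]
    · have h1 : ∀ᶠ s : I in 𝓝 t, (s : ℝ) ≠ 0 :=
        continuous_subtype_val.continuousAt.eventually_ne ht
      have h2 : ContinuousAt (fun s : I => ((g₀ s : ℂ) : CP1)) t := by
        refine OnePoint.continuous_coe.continuousAt.comp ?_
        have : ContinuousAt (fun s : I => (s : ℝ)⁻¹) t :=
          continuous_subtype_val.continuousAt.inv₀ ht
        exact continuousAt_const.add ((Complex.continuous_ofReal.continuousAt.comp
          (this.sub continuousAt_const)).mul continuousAt_const)
      refine h2.congr ?_
      filter_upwards [h1] with s hs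
      exact (if_neg hs).symm
  · intro s t hst
    simp only [hg] at hst
    by_cases hs : (s : ℝ) = 0 <;> by_cases ht : (t : ℝ) = 0
    · exact Subtype.ext (hs.trans ht.symm)
    · rw [if_pos hs, if_neg ht] at hst
      exact absurd hst (OnePoint.infty_ne_coe _)
    · rw [if_neg hs, if_pos ht] at hst
      exact absurd hst (OnePoint.coe_ne_infty _)
    · rw [if_neg hs, if_neg ht] at hst
      have := coe_add_mul_injective p v hv hst
      exact Subtype.ext (inv_injective (by linarith))
  · ext w
    constructor
    · rintro ⟨t, rfl⟩
      by_cases ht : (t : ℝ) = 0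
      · exact Or.inl (if_pos ht)
      · refine Or.inr ⟨(t : ℝ)⁻¹ - 1, ?_, (if_neg ht).symm⟩
        have h0 : 0 < (t : ℝ) := lt_of_le_of_ne t.2.1 (Ne.symm ht)
        have := (one_le_inv₀ h0).2 t.2.2
        simpa using this
    · rintro (rfl | ⟨t, ht, rfl⟩)
      · exact ⟨0, if_pos rfl⟩
      · have ht' : 0 ≤ t := ht
        have h1 : 0 < 1 + t := by linarith
        refine ⟨⟨(1 + t)⁻¹, by positivity, inv_le_one_of_one_le₀ (by linarith)⟩, ?_⟩
        simp only [hg, inv_eq_zero, if_neg h1.ne', hg₀, inv_inv, add_sub_cancel_left]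
  · rintro _ (rfl | ⟨t, -, rfl⟩)
    · exact hSi
    · exact hS' t

/-! ### The pinched curves -/

/-- The vertical shear `(x, y) ↦ (x, y + k x)`. -/
def vShear (k : ℝ → ℝ) (hk : Continuous k) : ℂ ≃ₜ ℂ where
  toFun z := z + (k z.re : ℂ) * Complex.I
  invFun z := z - (k z.re : ℂ) * Complex.I
  left_inv z := by simp
  right_inv z := by simp
  continuous_toFun := by fun_prop
  continuous_invFun := by fun_prop

/-- The horizontal shear `(x, y) ↦ (x - k y, y)`. -/
def hShear (k : ℝ → ℝ) (hk : Continuous k) : ℂ ≃ₜ ℂ where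
  toFun z := z - (k z.im : ℂ)
  invFun z := z + (k z.im : ℂ)
  left_inv z := by simp
  right_inv z := by simp
  continuous_toFun := by fun_prop
  continuous_invFun := by fun_prop

theorem lipschitzWith_vShear {k : ℝ → ℝ} (hk : Continuous k) {K : ℝ≥0} (hK : LipschitzWith K k) :
    LipschitzWith (1 + K) (vShear k hk) ∧ LipschitzWith (1 + K) (vShear k hk).symm := by
  have key : ∀ z w : ℂ, ‖((k z.re : ℂ) - (k w.re : ℂ)) * Complex.I‖ ≤ K * ‖z - w‖ := by
    intro z w
    rw [norm_mul, Complex.norm_I, mul_one, ← Complex.ofReal_sub, Complex.norm_real,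
      Real.norm_eq_abs, ← Real.dist_eq]
    refine (hK.dist_le_mul _ _).trans ?_
    gcongr
    rw [Real.dist_eq, ← Complex.sub_re]
    exact Complex.abs_re_le_norm _
  constructor
  · refine LipschitzWith.of_dist_le_mul fun z w => ?_
    have h : vShear k hk z - vShear k hk w =
        (z - w) + ((k z.re : ℂ) - (k w.re : ℂ)) * Complex.I := by
      change z + (k z.re : ℂ) * Complex.I - (w + (k w.re : ℂ) * Complex.I) = _
      ring
    rw [dist_eq_norm, dist_eq_norm, h, NNReal.coe_add, NNReal.coe_one, add_mul, one_mul]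
    exact (norm_add_le _ _).trans (by gcongr; exact key z w)
  · refine LipschitzWith.of_dist_le_mul fun z w => ?_
    have h : (vShear k hk).symm z - (vShear k hk).symm w =
        (z - w) - ((k z.re : ℂ) - (k w.re : ℂ)) * Complex.I := by
      change z - (k z.re : ℂ) * Complex.I - (w - (k w.re : ℂ) * Complex.I) = _
      ring
    rw [dist_eq_norm, dist_eq_norm, h, NNReal.coe_add, NNReal.coe_one, add_mul, one_mul]
    exact (norm_sub_le _ _).trans (by gcongr; exact key z w)

theorem lipschitzWith_hShear {k : ℝ → ℝ} (hk : Continuous k) {K : ℝ≥0} (hK : LipschitzWith K k) :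
    LipschitzWith (1 + K) (hShear k hk) ∧ LipschitzWith (1 + K) (hShear k hk).symm := by
  have key : ∀ z w : ℂ, ‖(k z.im : ℂ) - (k w.im : ℂ)‖ ≤ K * ‖z - w‖ := by
    intro z w
    rw [← Complex.ofReal_sub, Complex.norm_real, Real.norm_eq_abs, ← Real.dist_eq]
    refine (hK.dist_le_mul _ _).trans ?_
    gcongr
    rw [Real.dist_eq, ← Complex.sub_im]
    exact Complex.abs_im_le_norm _
  constructor
  · refine LipschitzWith.of_dist_le_mul fun z w => ?_
    have h : hShear k hk z - hShear k hk w = (z - w) - ((k z.im : ℂ) - (k w.im : ℂ)) := by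
      change z - (k z.im : ℂ) - (w - (k w.im : ℂ)) = _
      ring
    rw [dist_eq_norm, dist_eq_norm, h, NNReal.coe_add, NNReal.coe_one, add_mul, one_mul]
    exact (norm_sub_le _ _).trans (by gcongr; exact key z w)
  · refine LipschitzWith.of_dist_le_mul fun z w => ?_
    have h : (hShear k hk).symm z - (hShear k hk).symm w =
        (z - w) + ((k z.im : ℂ) - (k w.im : ℂ)) := by
      change z + (k z.im : ℂ) - (w + (k w.im : ℂ)) = _
      ring
    rw [dist_eq_norm, dist_eq_norm, h, NNReal.coe_add, NNReal.coe_one, add_mul, one_mul]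
    exact (norm_add_le _ _).trans (by gcongr; exact key z w)

/-- A zigzag with slopes `1, -1, 1`, a peak at `0` and a valley at `1`. -/
def zigzag (x : ℝ) : ℝ := max (-|x|) (x - 2)

/-- A ramp that increases from `0` to `4` on the interval `[0, ε]`. -/
def ramp (ε y : ℝ) : ℝ := 4 * max 0 (min (y / ε) 1)

theorem lipschitzWith_zigzag : LipschitzWith 1 zigzag := by
  have h1 : LipschitzWith 1 fun x : ℝ => -|x| := by
    exact LipschitzWith.of_dist_le_mul fun x y => by
      rw [dist_neg_neg, NNReal.coe_one, one_mul]
      exact abs_abs_sub_abs_le_abs_sub x y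
  have h2 : LipschitzWith 1 fun x : ℝ => x - 2 := by
    simpa using LipschitzWith.id.sub (LipschitzWith.const (2 : ℝ))
  simpa using! h1.max h2

theorem continuous_zigzag : Continuous zigzag := lipschitzWith_zigzag.continuous

theorem lipschitzWith_ramp (ε : ℝ) : LipschitzWith (4 * ‖ε⁻¹‖₊) (ramp ε) := by
  have h1 : LipschitzWith (‖ε⁻¹‖₊) fun y : ℝ => y / ε :=
    LipschitzWith.of_dist_le_mul fun x y => by
      rw [Real.dist_eq, Real.dist_eq, ← sub_div, div_eq_inv_mul, abs_mul]
      rfl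
  refine LipschitzWith.of_dist_le_mul fun x y => ?_
  have h2 := ((h1.min_const 1).const_max 0).dist_le_mul x y
  rw [ramp, ramp, Real.dist_eq, ← mul_sub, abs_mul, ← Real.dist_eq]
  simp only [NNReal.coe_mul, NNReal.coe_ofNat, abs_of_pos (zero_lt_four' ℝ), mul_assoc]
  gcongr

theorem continuous_ramp (ε : ℝ) : Continuous (ramp ε) := (lipschitzWith_ramp ε).continuous

theorem abs_zigzag_sub_le (x y : ℝ) : |zigzag x - zigzag y| ≤ |x - y| := by
  simpa [Real.dist_eq] using lipschitzWith_zigzag.dist_le_mul x y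

theorem sub_two_le_zigzag (x : ℝ) : x - 2 ≤ zigzag x := le_max_right _ _

theorem zigzag_le (x : ℝ) : zigzag x ≤ max 0 (x - 2) := by
  rw [zigzag]
  gcongr
  simp

theorem zigzag_of_nonpos {x : ℝ} (hx : x ≤ 0) : zigzag x = x := by
  rw [zigzag, abs_of_nonpos hx, neg_neg]
  exact max_eq_left (by linarith)

theorem zigzag_of_mem_Icc {x : ℝ} (h0 : 0 ≤ x) (h1 : x ≤ 1) : zigzag x = -x := by
  rw [zigzag, abs_of_nonneg h0]
  exact max_eq_left (by linarith)

theorem zigzag_of_one_le {x : ℝ} (hx : 1 ≤ x) : zigzag x = x - 2 := by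
  rw [zigzag, abs_of_nonneg (by linarith)]
  exact max_eq_right (by linarith)

theorem ramp_mono {ε : ℝ} (hε : 0 < ε) : Monotone (ramp ε) := fun x y hxy => by
  rw [ramp, ramp]
  gcongr

theorem ramp_of_nonpos {ε y : ℝ} (hε : 0 < ε) (hy : y ≤ 0) : ramp ε y = 0 := by
  have : y / ε ≤ 0 := div_nonpos_of_nonpos_of_nonneg hy hε.le
  rw [ramp, min_eq_left (by linarith), max_eq_left this, mul_zero]

theorem ramp_of_mem_Icc {ε y : ℝ} (hε : 0 < ε) (hy : 0 ≤ y) (hyε : y ≤ ε) :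
    ramp ε y = 4 * (y / ε) := by
  rw [ramp, min_eq_left ((div_le_one hε).2 hyε), max_eq_right (by positivity)]

theorem ramp_of_le {ε y : ℝ} (hε : 0 < ε) (hy : ε ≤ y) : ramp ε y = 4 := by
  rw [ramp, min_eq_right ((one_le_div hε).2 hy), max_eq_right zero_le_one, mul_one]

/-- The homeomorphism of the plane that carries the real line to the curve. -/
def planeMap (ε : ℝ) : ℂ ≃ₜ ℂ :=
  (vShear zigzag continuous_zigzag).trans (hShear (ramp ε) (continuous_ramp ε))

theorem planeMap_symm_apply (ε : ℝ) (z : ℂ) :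
    (planeMap ε).symm z = ⟨z.re + ramp ε z.im, z.im - zigzag (z.re + ramp ε z.im)⟩ := by
  apply Complex.ext <;> simp [planeMap, vShear, hShear]

/-- The curve obtained from the graph of the zigzag by moving the part above height `ε` by `4` to
the left. The strand that crosses the strip of height `ε` passes just above the peak at `0`. -/
def pinchedCurve (ε : ℝ) : Set CP1 := (planeMap ε).onePointCongr '' RP1

theorem infty_mem_pinchedCurve (ε : ℝ) : OnePoint.infty ∈ pinchedCurve ε :=
  ⟨OnePoint.infty, Or.inl rfl, rfl⟩

/-- The curve is the graph of the zigzag in the sheared coordinates. -/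
theorem coe_mem_pinchedCurve {ε : ℝ} {z : ℂ} :
    (z : CP1) ∈ pinchedCurve ε ↔ z.im = zigzag (z.re + ramp ε z.im) := by
  rw [pinchedCurve, Homeomorph.image_eq_preimage_symm, mem_preimage]
  change (((planeMap ε).symm z : ℂ) : CP1) ∈ RP1 ↔ _
  rw [mem_RP1_coe, planeMap_symm_apply, sub_eq_zero]

theorem isClosed_pinchedCurve (ε : ℝ) : IsClosed (pinchedCurve ε) := by
  obtain ⟨g, hg, -, h⟩ := isJordanCurve_RP1.image (planeMap ε).onePointCongr
  rw [pinchedCurve, ← h]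
  exact (isCompact_range hg).isClosed

theorem isQuasicircle_pinchedCurve (ε : ℝ) : ∃ K, IsQuasicircle K (pinchedCurve ε) := by
  obtain ⟨hv, hv'⟩ := lipschitzWith_vShear continuous_zigzag lipschitzWith_zigzag
  obtain ⟨hh, hh'⟩ := lipschitzWith_hShear (continuous_ramp ε) (lipschitzWith_ramp ε)
  refine ⟨_, isJordanCurve_RP1.image _, (planeMap ε).onePointCongr,
    isQuasiconformal_onePointCongr (planeMap ε)
      (L := (1 + 4 * ‖ε⁻¹‖₊) * (1 + 1)) ?_ (hh.comp hv) ?_, rfl⟩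
  · exact one_le_mul (le_add_of_nonneg_right zero_le) (le_add_of_nonneg_right zero_le)
  · rw [mul_comm]
    exact hv'.comp hh'

/-- The regions above and below the curve. -/
def region (ε : ℝ) : Bool → Set ℂ
  | true => {z | zigzag (z.re + ramp ε z.im) < z.im}
  | false => {z | z.im < zigzag (z.re + ramp ε z.im)}

theorem isOpen_region (ε : ℝ) (i : Bool) : IsOpen (region ε i) := by
  have h : Continuous fun z : ℂ => zigzag (z.re + ramp ε z.im) :=
    continuous_zigzag.comp (Complex.continuous_re.add
      ((continuous_ramp ε).comp Complex.continuous_im))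
  cases i
  · exact isOpen_lt Complex.continuous_im h
  · exact isOpen_lt h Complex.continuous_im

theorem isPreconnected_region (ε : ℝ) (i : Bool) : IsPreconnected (region ε i) := by
  cases i
  · have h : region ε false = planeMap ε '' {z | z.im < 0} := by
      rw [Homeomorph.image_eq_preimage_symm]
      ext z
      simp [region, planeMap_symm_apply]
    rw [h]
    exact (convex_halfSpace_im_lt 0).isPreconnected.image _ (planeMap ε).continuous.continuousOn
  · have h : region ε true = planeMap ε '' {z | 0 < z.im} := by
      rw [Homeomorph.image_eq_preimage_symm]
      ext z
      simp [region, planeMap_symm_apply]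
    rw [h]
    exact (convex_halfSpace_im_gt 0).isPreconnected.image _ (planeMap ε).continuous.continuousOn

theorem notMem_pinchedCurve_of_mem_region {ε : ℝ} {i : Bool} {z : ℂ} (hz : z ∈ region ε i) :
    (z : CP1) ∉ pinchedCurve ε := by
  rw [coe_mem_pinchedCurve]
  cases i
  · exact (show _ < _ from hz).ne
  · exact (show _ < _ from hz).ne'

theorem exists_mem_region {ε : ℝ} {z : ℂ} (hz : (z : CP1) ∉ pinchedCurve ε) :
    ∃ i, z ∈ region ε i := by
  rw [coe_mem_pinchedCurve] at hz
  rcases lt_or_gt_of_ne hz with h | h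
  · exact ⟨false, h⟩
  · exact ⟨true, h⟩

theorem zero_mem_pinchedCurve {ε : ℝ} (hε : 0 < ε) : ((0 : ℂ) : CP1) ∈ pinchedCurve ε := by
  rw [coe_mem_pinchedCurve]
  simp [ramp_of_nonpos hε le_rfl, zigzag_of_nonpos le_rfl]

/-- The three parts of the curve: below the strip, inside the strip, and above it. -/
theorem coe_mem_pinchedCurve_iff {ε : ℝ} (hε : 0 < ε) {z : ℂ} :
    (z : CP1) ∈ pinchedCurve ε ↔ (z.re ≤ 2 ∧ z.im = zigzag z.re) ∨
      (0 ≤ z.im ∧ z.im ≤ ε ∧ z.re = 2 + z.im - 4 * (z.im / ε)) ∨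
      (ε ≤ z.im ∧ z.re = z.im - 2) := by
  rw [coe_mem_pinchedCurve]
  constructor
  · intro h
    rcases le_or_gt z.im 0 with h0 | h0
    · rw [ramp_of_nonpos hε h0, add_zero] at h
      have := sub_two_le_zigzag z.re
      exact Or.inl ⟨by linarith, h⟩
    · have h1 : z.re + ramp ε z.im = z.im + 2 := by
        have h2 := zigzag_le (z.re + ramp ε z.im)
        have h3 := sub_two_le_zigzag (z.re + ramp ε z.im)
        rcases le_or_gt (z.re + ramp ε z.im - 2) 0 with h4 | h4
        · rw [max_eq_left h4] at h2
          linarith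
        · rw [max_eq_right h4.le] at h2
          linarith
      rcases le_total z.im ε with h2 | h2
      · rw [ramp_of_mem_Icc hε h0.le h2] at h1
        exact Or.inr (Or.inl ⟨h0.le, h2, by linarith⟩)
      · rw [ramp_of_le hε h2] at h1
        exact Or.inr (Or.inr ⟨h2, by linarith⟩)
  · rintro (⟨h1, h2⟩ | ⟨h1, h2, h3⟩ | ⟨h1, h2⟩)
    · have h3 := zigzag_le z.re
      rw [max_eq_left (by linarith)] at h3
      rw [ramp_of_nonpos hε (by linarith), add_zero, h2]
    · rw [ramp_of_mem_Icc hε h1 h2, h3, sub_add_cancel, zigzag_of_one_le (by linarith)]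
      ring
    · rw [ramp_of_le hε h1, h2, zigzag_of_one_le (by linarith)]
      ring

theorem isPiecewiseCircular_pinchedCurve {ε : ℝ} (hε : 0 < ε) :
    IsPiecewiseCircular (pinchedCurve ε) := by
  have hne : ∀ a b : ℝ, b ≠ 0 → (⟨a, b⟩ : ℂ) ≠ 0 := fun a b hb h => hb (congrArg Complex.im h)
  refine ⟨{raySet 0 ⟨-1, -1⟩, segmentSet 0 ⟨1, -1⟩, segmentSet ⟨1, -1⟩ ⟨1, 1⟩,
    segmentSet ⟨2, 0⟩ ⟨ε - 4, ε⟩, raySet ⟨ε - 2, ε⟩ ⟨1, 1⟩}, Set.toFinite _, ?_, ?_⟩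
  · rintro A (rfl | rfl | rfl | rfl | rfl)
    · exact isCircularArc_raySet _ _ (hne _ _ (by norm_num))
    · exact isCircularArc_segmentSet _ _ (hne _ _ (by norm_num))
    · exact isCircularArc_segmentSet _ _ (hne _ _ (by norm_num))
    · exact isCircularArc_segmentSet _ _ (hne _ _ hε.ne')
    · exact isCircularArc_raySet _ _ (hne _ _ (by norm_num))
  · apply Subset.antisymm
    · rintro w ⟨A, (rfl | rfl | rfl | rfl | rfl), hw⟩
      · obtain rfl | ⟨t, ht, rfl⟩ := hw
        · exact infty_mem_pinchedCurve ε
        · have ht : 0 ≤ t := ht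
          rw [coe_mem_pinchedCurve_iff hε]
          left
          simp only [Complex.add_re, Complex.add_im, Complex.re_ofReal_mul, Complex.im_ofReal_mul,
            Complex.zero_re, Complex.zero_im]
          rw [zigzag_of_nonpos (by linarith)]
          exact ⟨by linarith, by ring⟩
      · obtain ⟨t, ht, rfl⟩ := hw
        rw [coe_mem_pinchedCurve_iff hε]
        left
        simp only [Complex.add_re, Complex.add_im, Complex.re_ofReal_mul, Complex.im_ofReal_mul,
          Complex.zero_re, Complex.zero_im]
        rw [zigzag_of_mem_Icc (by linarith [ht.1]) (by linarith [ht.2])]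
        exact ⟨by linarith [ht.2], by ring⟩
      · obtain ⟨t, ht, rfl⟩ := hw
        rw [coe_mem_pinchedCurve_iff hε]
        left
        simp only [Complex.add_re, Complex.add_im, Complex.re_ofReal_mul, Complex.im_ofReal_mul]
        rw [zigzag_of_one_le (by linarith [ht.1])]
        exact ⟨by linarith [ht.2], by ring⟩
      · obtain ⟨t, ht, rfl⟩ := hw
        rw [coe_mem_pinchedCurve_iff hε]
        right; left
        simp only [Complex.add_re, Complex.add_im, Complex.re_ofReal_mul, Complex.im_ofReal_mul,
          zero_add, mul_div_cancel_right₀ _ hε.ne']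
        exact ⟨mul_nonneg ht.1 hε.le, mul_le_of_le_one_left hε.le ht.2, by ring⟩
      · obtain rfl | ⟨t, ht, rfl⟩ := hw
        · exact infty_mem_pinchedCurve ε
        · have ht : 0 ≤ t := ht
          rw [coe_mem_pinchedCurve_iff hε]
          right; right
          simp only [Complex.add_re, Complex.add_im, Complex.re_ofReal_mul, Complex.im_ofReal_mul]
          exact ⟨by linarith, by ring⟩
    · intro w hw
      induction w using OnePoint.rec with
      | infty => exact ⟨_, Or.inl rfl, Or.inl rfl⟩
      | coe z =>
        rcases (coe_mem_pinchedCurve_iff hε).1 hw with ⟨h1, h2⟩ | ⟨h1, h2, h3⟩ | ⟨h1, h2⟩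
        · rcases le_total z.re 0 with h3 | h3
          · rw [zigzag_of_nonpos h3] at h2
            refine ⟨_, Or.inl rfl, Or.inr ⟨-z.re, neg_nonneg.2 h3, congrArg _ ?_⟩⟩
            apply Complex.ext <;> simp [h2]
          · rcases le_total z.re 1 with h4 | h4
            · rw [zigzag_of_mem_Icc h3 h4] at h2
              refine ⟨_, Or.inr (Or.inl rfl), z.re, ⟨h3, h4⟩, congrArg _ ?_⟩
              apply Complex.ext <;> simp [h2]
            · rw [zigzag_of_one_le h4] at h2
              refine ⟨_, Or.inr (Or.inr (Or.inl rfl)), z.re - 1, ⟨by linarith, by linarith⟩,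
                congrArg _ ?_⟩
              apply Complex.ext
              · simp
              · simp [h2]; ring
        · refine ⟨_, Or.inr (Or.inr (Or.inr (Or.inl rfl))), z.im / ε,
            ⟨by positivity, (div_le_one hε).2 h2⟩, congrArg _ ?_⟩
          apply Complex.ext
          · rw [Complex.add_re, Complex.re_ofReal_mul, h3]
            field_simp
            ring
          · rw [Complex.add_im, Complex.im_ofReal_mul]
            field_simp
            ring
        · refine ⟨_, Or.inr (Or.inr (Or.inr (Or.inr rfl))),
            Or.inr ⟨z.im - ε, sub_nonneg.2 h1, congrArg _ ?_⟩⟩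
          apply Complex.ext
          · rw [Complex.add_re, Complex.re_ofReal_mul, h2]
            ring
          · rw [Complex.add_im, Complex.im_ofReal_mul]
            ring

/-! ### The corkscrew condition -/

/-- A disk around `w` is in a set as soon as a square around `w` is. -/
theorem ball_subset_of_square {S : Set ℂ} {a b r : ℝ}
    (h : ∀ x y : ℝ, |x - a| < r → |y - b| < r → (⟨x, y⟩ : ℂ) ∈ S) :
    Metric.ball (⟨a, b⟩ : ℂ) r ⊆ S := by
  intro z hz
  rw [Metric.mem_ball, dist_eq_norm] at hz
  refine h z.re z.im ?_ ?_
  · exact (Complex.abs_re_le_norm (z - ⟨a, b⟩)).trans_lt hz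
  · exact (Complex.abs_im_le_norm (z - ⟨a, b⟩)).trans_lt hz

theorem norm_sub_le_abs_add_abs (a b : ℝ) (c : ℂ) :
    ‖(⟨a, b⟩ : ℂ) - c‖ ≤ |a - c.re| + |b - c.im| :=
  Complex.norm_le_abs_re_add_abs_im _

/-- The region below the curve satisfies the corkscrew condition: to the right of the last rising
strand it contains a cone, and below the other strands it looks like the region below a Lipschitz
graph. -/
theorem corkscrew_below {ε : ℝ} (hε : 0 < ε) {c : ℂ} (hc : (c : CP1) ∈ pinchedCurve ε) {t : ℝ}
    (ht : 0 < t) : ∃ w : ℂ, ‖w - c‖ ≤ 16 * t ∧ Metric.ball w (1 / 4 * t) ⊆ region ε false := by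
  have hc' := coe_mem_pinchedCurve.1 hc
  rcases le_total 1 (c.re + ramp ε c.im) with h1 | h1
  · rw [zigzag_of_one_le h1] at hc'
    refine ⟨⟨c.re + 3 * t, c.im + t⟩, (norm_sub_le_abs_add_abs _ _ _).trans ?_,
      ball_subset_of_square fun x y hx hy => ?_⟩
    · rw [add_sub_cancel_left, add_sub_cancel_left, abs_of_pos ht, abs_of_pos (by linarith)]
      linarith
    · rw [abs_lt] at hx hy
      have h2 := ramp_mono hε (show c.im ≤ y by linarith)
      have h3 := sub_two_le_zigzag (x + ramp ε y)
      change y < zigzag (x + ramp ε y)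
      linarith
  · have h0 : c.im ≤ 0 := by
      have := zigzag_le (c.re + ramp ε c.im)
      rw [max_eq_left (by linarith)] at this
      linarith
    rw [ramp_of_nonpos hε h0, add_zero] at hc'
    refine ⟨⟨c.re, c.im - t⟩, (norm_sub_le_abs_add_abs _ _ _).trans ?_,
      ball_subset_of_square fun x y hx hy => ?_⟩
    · rw [sub_self, sub_sub_cancel_left, abs_neg, abs_of_pos ht, abs_zero]
      linarith
    · have h2 := abs_le.1 (abs_zigzag_sub_le x c.re)
      rw [abs_lt] at hy
      change y < zigzag (x + ramp ε y)
      rw [ramp_of_nonpos hε (by linarith), add_zero]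
      linarith

/-- The wedge to the left of the peak contains disks at all scales. -/
theorem ball_subset_left_wedge {ε : ℝ} (hε : 0 < ε) {t : ℝ} (ht : 0 < t) {a : ℝ} (ha : a ≤ 0) :
    Metric.ball (⟨a - 2 * t, -t⟩ : ℂ) (1 / 4 * t) ⊆ region ε true := by
  refine ball_subset_of_square fun x y hx hy => ?_
  rw [abs_lt] at hx hy
  change zigzag (x + ramp ε y) < y
  rw [ramp_of_nonpos hε (by linarith), add_zero, zigzag_of_nonpos (by linarith)]
  linarith

/-- The triangle to the right of the peak contains disks. -/
theorem ball_subset_triangle {ε : ℝ} (hε : 0 < ε) {t : ℝ} {a : ℝ}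
    (h1 : 5 / 4 * t < a - 1 / 4 * t) (h2 : a + 1 / 4 * t < 2 - 5 / 4 * t) :
    Metric.ball (⟨a, -t⟩ : ℂ) (1 / 4 * t) ⊆ region ε true := by
  refine ball_subset_of_square fun x y hx hy => ?_
  have ht : 0 < 1 / 4 * t := (abs_nonneg _).trans_lt hx
  rw [abs_lt] at hx hy
  change zigzag (x + ramp ε y) < y
  rw [ramp_of_nonpos hε (by linarith), add_zero]
  refine max_lt ?_ (by linarith)
  rw [abs_of_pos (by linarith)]
  linarith

/-- At scales comparable to the distance from `0`, the wedge to the left of the peak provides the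
disk. -/
theorem corkscrew_above_of_large {ε : ℝ} (hε : 0 < ε) {c : ℂ} {t : ℝ} (ht : 0 < t)
    (h : |c.re| + |c.im| ≤ 13 * t) :
    ∃ w : ℂ, ‖w - c‖ ≤ 16 * t ∧ Metric.ball w (1 / 4 * t) ⊆ region ε true := by
  refine ⟨⟨0 - 2 * t, -t⟩, (norm_sub_le_abs_add_abs _ _ _).trans ?_,
    ball_subset_left_wedge hε ht le_rfl⟩
  have h1 : |-(2 * t) - c.re| ≤ |-(2 * t)| + |c.re| := abs_sub _ _
  have h2 : |-t - c.im| ≤ |-t| + |c.im| := abs_sub _ _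
  rw [abs_neg (2 * t), abs_of_pos (mul_pos two_pos ht)] at h1
  rw [abs_neg t, abs_of_pos ht] at h2
  rw [zero_sub]
  linarith

/-- The region above the curve satisfies the corkscrew condition. Near the strand inside the strip
the disks are found below it, in the strip at small scales, and in the wedges on the two sides of
the peak at larger scales. -/
theorem corkscrew_above {ε : ℝ} (hε : 0 < ε) (hε1 : ε ≤ 1) {c : ℂ}
    (hc : (c : CP1) ∈ pinchedCurve ε) {t : ℝ} (ht : 0 < t) :
    ∃ w : ℂ, ‖w - c‖ ≤ 16 * t ∧ Metric.ball w (1 / 4 * t) ⊆ region ε true := by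
  rcases (coe_mem_pinchedCurve_iff hε).1 hc with ⟨h1, h2⟩ | ⟨h1, h2, h3⟩ | ⟨h1, h2⟩
  · have h0 : c.im ≤ 0 := by
      have := zigzag_le c.re
      rw [max_eq_left (by linarith)] at this
      linarith
    rcases le_or_gt t (-c.im / 2) with h3 | h3
    · refine ⟨⟨c.re, c.im + t⟩, (norm_sub_le_abs_add_abs _ _ _).trans ?_,
        ball_subset_of_square fun x y hx hy => ?_⟩
      · rw [sub_self, add_sub_cancel_left, abs_of_pos ht, abs_zero]
        linarith
      · have h4 := abs_le.1 (abs_zigzag_sub_le x c.re)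
        rw [abs_lt] at hy
        change zigzag (x + ramp ε y) < y
        rw [ramp_of_nonpos hε (by linarith), add_zero]
        linarith
    · rcases le_total c.re 1 with h4 | h4
      · refine corkscrew_above_of_large hε ht ?_
        rw [abs_of_nonpos h0]
        have h5 : |c.re| = -c.im := by
          rcases le_total c.re 0 with h5 | h5
          · rw [abs_of_nonpos h5, h2, zigzag_of_nonpos h5]
          · rw [abs_of_nonneg h5, h2, zigzag_of_mem_Icc h5 h4, neg_neg]
        linarith
      · rw [zigzag_of_one_le h4] at h2
        rcases le_or_gt t (1 / 4) with h5 | h5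
        · refine ⟨⟨2 - 2 * t, -t⟩, (norm_sub_le_abs_add_abs _ _ _).trans ?_,
            ball_subset_triangle hε (by linarith) (by linarith)⟩
          have h6 : |2 - 2 * t - c.re| ≤ 4 * t := abs_le.2 ⟨by linarith, by linarith⟩
          have h7 : |-t - c.im| ≤ 4 * t := abs_le.2 ⟨by linarith, by linarith⟩
          linarith
        · refine corkscrew_above_of_large hε ht ?_
          rw [abs_of_nonpos h0, abs_of_nonneg (by linarith)]
          linarith
  · have h4 : c.im ≤ c.im / ε := (le_div_iff₀ hε).2 (mul_le_of_le_one_right h1 hε1)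
    have h5 : c.im / ε ≤ 1 := (div_le_one hε).2 h2
    rcases le_or_gt t c.im with h6 | h6
    · refine ⟨⟨c.re - 3 / 2 * t, c.im - 1 / 2 * t⟩, (norm_sub_le_abs_add_abs _ _ _).trans ?_,
        ball_subset_of_square fun x y hx hy => ?_⟩
      · rw [sub_sub_cancel_left, sub_sub_cancel_left, abs_neg, abs_neg, abs_of_pos (by linarith),
          abs_of_pos (by linarith)]
        linarith
      · rw [abs_lt] at hx hy
        have h7 := ramp_mono hε (show y ≤ c.im by linarith)
        rw [ramp_of_mem_Icc hε h1 h2] at h7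
        change zigzag (x + ramp ε y) < y
        refine (zigzag_le _).trans_lt (max_lt (by linarith) (by linarith))
    · rcases le_or_gt t (1 / 4) with h7 | h7
      · have h8 : |-t - c.im| ≤ 2 * t := abs_le.2 ⟨by linarith, by linarith⟩
        rcases le_total c.re 0 with h9 | h9
        · refine ⟨⟨c.re - 2 * t, -t⟩, (norm_sub_le_abs_add_abs _ _ _).trans ?_,
            ball_subset_left_wedge hε ht h9⟩
          rw [sub_sub_cancel_left, abs_neg, abs_of_pos (by linarith)]
          linarith
        · rcases le_total c.re 1 with h10 | h10
          · refine ⟨⟨c.re + 2 * t, -t⟩, (norm_sub_le_abs_add_abs _ _ _).trans ?_,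
              ball_subset_triangle hε (by linarith) (by linarith)⟩
            rw [add_sub_cancel_left, abs_of_pos (by linarith)]
            linarith
          · refine ⟨⟨c.re - 2 * t, -t⟩, (norm_sub_le_abs_add_abs _ _ _).trans ?_,
              ball_subset_triangle hε (by linarith) (by linarith)⟩
            rw [sub_sub_cancel_left, abs_neg, abs_of_pos (by linarith)]
            linarith
      · refine corkscrew_above_of_large hε ht ?_
        have h8 : |c.re| ≤ 2 := abs_le.2 ⟨by linarith, by linarith⟩
        rw [abs_of_nonneg h1]
        linarith
  · refine ⟨⟨c.re, c.im + t⟩, (norm_sub_le_abs_add_abs _ _ _).trans ?_,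
      ball_subset_of_square fun x y hx hy => ?_⟩
    · rw [sub_self, add_sub_cancel_left, abs_of_pos ht, abs_zero]
      linarith
    · rw [abs_lt] at hx hy
      change zigzag (x + ramp ε y) < y
      rw [ramp_of_le hε (by linarith)]
      exact (zigzag_le _).trans_lt (max_lt (by linarith) (by linarith))

theorem width_pinchedCurve_le {ε : ℝ} (hε : 0 < ε) (hε1 : ε ≤ 1) :
    width (pinchedCurve ε) ≤ ENNReal.ofReal (Real.arcosh (((16 + 2) ^ 2 + 2) / (1 / 4))) +
      ENNReal.ofReal (Real.arcosh (((16 + 2) ^ 2 + 2) / (1 / 4))) := by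
  have h0 := zero_mem_pinchedCurve hε
  refine width_le (Ω := region ε) (isClosed_pinchedCurve ε)
    ⟨_, infty_mem_pinchedCurve ε, _, h0, OnePoint.infty_ne_coe _⟩ (isOpen_region ε)
    (isPreconnected_region ε) (fun i => ⟨0, fun h => notMem_pinchedCurve_of_mem_region h h0⟩)
    (fun i z hz => notMem_pinchedCurve_of_mem_region hz) (fun z hz => exists_mem_region hz)
    (by norm_num) (by norm_num) (by norm_num) fun i c hc t ht => ?_
  cases i
  · exact corkscrew_below hε hc ht
  · exact corkscrew_above hε hε1 hc ht

/-! ### The limit set -/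

/-- The limit of the pinched curves: a triangle with a vertex at `0`, together with two arcs from
`0` to `∞`. -/
def limitSet : Set CP1 :=
  insert OnePoint.infty (((↑) : ℂ → CP1) '' {z | (z.re ≤ 2 ∧ z.im = zigzag z.re) ∨
    (z.im = 0 ∧ -2 ≤ z.re ∧ z.re ≤ 2) ∨ (-2 ≤ z.re ∧ z.im = z.re + 2)})

theorem coe_mem_limitSet {z : ℂ} : (z : CP1) ∈ limitSet ↔ (z.re ≤ 2 ∧ z.im = zigzag z.re) ∨
    (z.im = 0 ∧ -2 ≤ z.re ∧ z.re ≤ 2) ∨ (-2 ≤ z.re ∧ z.im = z.re + 2) := by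
  constructor
  · rintro (h | ⟨w, hw, h⟩)
    · exact absurd h (OnePoint.coe_ne_infty z)
    · rw [OnePoint.coe_injective h] at hw
      exact hw
  · exact fun h => Or.inr ⟨z, h, rfl⟩

theorem infty_mem_limitSet : OnePoint.infty ∈ limitSet := Or.inl rfl

theorem isClosed_limitSet : IsClosed limitSet := by
  rw [OnePoint.isClosed_iff_of_mem infty_mem_limitSet]
  have : ((↑) : ℂ → CP1) ⁻¹' limitSet = {z : ℂ | (z.re ≤ 2 ∧ z.im = zigzag z.re) ∨
      (z.im = 0 ∧ -2 ≤ z.re ∧ z.re ≤ 2) ∨ (-2 ≤ z.re ∧ z.im = z.re + 2)} :=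
    Set.ext fun z => coe_mem_limitSet
  rw [this]
  have hre := Complex.continuous_re
  have him := Complex.continuous_im
  refine IsClosed.union (IsClosed.inter ?_ ?_) (IsClosed.union (IsClosed.inter ?_
    (IsClosed.inter ?_ ?_)) (IsClosed.inter ?_ ?_))
  · exact isClosed_le hre continuous_const
  · exact isClosed_eq him (continuous_zigzag.comp hre)
  · exact isClosed_eq him continuous_const
  · exact isClosed_le continuous_const hre
  · exact isClosed_le hre continuous_const
  · exact isClosed_le continuous_const hre
  · exact isClosed_eq him (hre.add continuous_const)

/-- The vertex `0` is a cut point of the limit set. -/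
theorem not_isJordanCurve_limitSet : ¬ IsJordanCurve limitSet := by
  intro h
  have h0 : ((0 : ℂ) : CP1) ∈ limitSet :=
    coe_mem_limitSet.2 (Or.inl ⟨by simp, by simp [zigzag_of_nonpos le_rfl]⟩)
  have hpre := h.isPreconnected_diff_singleton h0
  have hre := Complex.continuous_re
  have him := Complex.continuous_im
  set u : Set ℂ := {z | 0 < z.re ∧ z.im < z.re + 1} with hu
  set v : Set ℂ := {z | z.re < 0 ∨ z.re + 1 < z.im} with hv
  have huo : IsOpen (((↑) : ℂ → CP1) '' u) := OnePoint.isOpen_image_coe.2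
    ((isOpen_lt continuous_const hre).inter (isOpen_lt him (hre.add continuous_const)))
  have hvo : IsOpen (((↑) : ℂ → CP1) '' v) := OnePoint.isOpen_image_coe.2
    ((isOpen_lt hre continuous_const).union (isOpen_lt (hre.add continuous_const) him))
  have hio : IsOpen ((((↑) : ℂ → CP1) '' Metric.closedBall 0 4)ᶜ) := by
    rw [OnePoint.isOpen_compl_image_coe]
    exact ⟨Metric.isClosed_closedBall, isCompact_closedBall _ _⟩
  have hnorm : ∀ z : ℂ, ‖z‖ ≤ |z.re| + |z.im| := Complex.norm_le_abs_re_add_abs_im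
  have hzz : ∀ z : ℂ, 0 ≤ z.re → z.re ≤ 2 → -1 ≤ zigzag z.re ∧ zigzag z.re ≤ 0 := by
    intro z h1 h2
    refine ⟨?_, ?_⟩
    · rcases le_total z.re 1 with h3 | h3
      · rw [zigzag_of_mem_Icc h1 h3]; linarith
      · rw [zigzag_of_one_le h3]; linarith
    · have := zigzag_le z.re
      rwa [max_eq_left (by linarith)] at this
  have hmem : ∀ z : ℂ, (z : CP1) ∈ ((↑) : ℂ → CP1) '' Metric.closedBall (0 : ℂ) 4 ↔ ‖z‖ ≤ 4 := by
    intro z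
    rw [OnePoint.coe_injective.mem_set_image, mem_closedBall_zero_iff]
  have hcov : limitSet \ {((0 : ℂ) : CP1)} ⊆ ((↑) : ℂ → CP1) '' u ∪
      (((↑) : ℂ → CP1) '' v ∪ (((↑) : ℂ → CP1) '' Metric.closedBall 0 4)ᶜ) := by
    rintro w ⟨hw, hw0⟩
    induction w using OnePoint.rec with
    | infty => exact Or.inr (Or.inr OnePoint.infty_notMem_image_coe)
    | coe z =>
      have hz0 : z ≠ 0 := fun h => hw0 (congrArg _ h)
      have hinj := OnePoint.coe_injective (X := ℂ)
      simp only [mem_union, hinj.mem_set_image]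
      rcases lt_trichotomy z.re 0 with h1 | h1 | h1
      · exact Or.inr (Or.inl (Or.inl h1))
      · refine Or.inr (Or.inl (Or.inr ?_))
        rcases coe_mem_limitSet.1 hw with ⟨h4, h5⟩ | ⟨h4, h5, h6⟩ | ⟨h4, h5⟩
        · rw [zigzag_of_nonpos h1.le, h1] at h5
          exact absurd (Complex.ext h1 h5) hz0
        · exact absurd (Complex.ext h1 h4) hz0
        · linarith
      · rcases coe_mem_limitSet.1 hw with ⟨h4, h5⟩ | ⟨h4, h5, h6⟩ | ⟨h4, h5⟩
        · exact Or.inl ⟨h1, by have := (hzz z h1.le h4).2; linarith⟩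
        · exact Or.inl ⟨h1, by linarith⟩
        · exact Or.inr (Or.inl (Or.inr (by linarith)))
  have hne1 : ((limitSet \ {((0 : ℂ) : CP1)}) ∩ ((↑) : ℂ → CP1) '' u).Nonempty := by
    refine ⟨((1 : ℂ) : CP1), ⟨coe_mem_limitSet.2 (Or.inr (Or.inl ?_)), ?_⟩, 1, ?_, rfl⟩
    · norm_num
    · exact fun h => one_ne_zero (OnePoint.coe_injective h)
    · simp [hu]
  have hne2 : ((limitSet \ {((0 : ℂ) : CP1)}) ∩
      (((↑) : ℂ → CP1) '' v ∪ (((↑) : ℂ → CP1) '' Metric.closedBall 0 4)ᶜ)).Nonempty := by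
    refine ⟨((-1 : ℂ) : CP1), ⟨coe_mem_limitSet.2 (Or.inr (Or.inl ?_)), ?_⟩, Or.inl ⟨-1, ?_, rfl⟩⟩
    · norm_num
    · exact fun h => neg_ne_zero.2 one_ne_zero (OnePoint.coe_injective h)
    · simp [hv]
  obtain ⟨w, hwL, hwu, hwv⟩ := hpre _ _ huo (hvo.union hio) hcov hne1 hne2
  obtain ⟨z, hz, rfl⟩ := hwu
  obtain ⟨h1, h2⟩ : 0 < z.re ∧ z.im < z.re + 1 := hz
  have h3 : z.re ≤ 2 ∧ -1 ≤ z.im ∧ z.im ≤ 0 := by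
    rcases coe_mem_limitSet.1 hwL.1 with ⟨h4, h5⟩ | ⟨h4, h5, h6⟩ | ⟨h4, h5⟩
    · have := hzz z h1.le h4
      exact ⟨h4, by linarith, by linarith⟩
    · exact ⟨h6, by linarith, by linarith⟩
    · linarith
  rcases hwv with hwv | hwv
  · rw [OnePoint.coe_injective.mem_set_image] at hwv
    rcases (hwv : z.re < 0 ∨ z.re + 1 < z.im) with h4 | h4 <;> linarith
  · refine hwv ((hmem z).2 ((hnorm z).trans ?_))
    rw [abs_of_pos h1, abs_of_nonpos h3.2.2]
    linarith

theorem dist_toSphere_coe_le (z w : ℂ) : dist (toSphere z) (toSphere w) ≤ 2 * ‖z - w‖ := by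
  refine abs_le_of_sq_le_sq' ?_ (by positivity) |>.2
  have h1 := one_sub_inner_halfSpacePt z w 0 0
  rw [← toSphere_coe, ← toSphere_coe] at h1
  rw [dist_eq_norm, norm_sub_sq_real, norm_toSphere, norm_toSphere]
  have h2 : 2 * (‖z - w‖ ^ 2 + 0 ^ 2 + 0 ^ 2) /
      ((‖z‖ ^ 2 + 0 ^ 2 + 1) * (‖w‖ ^ 2 + 0 ^ 2 + 1)) ≤ 2 * ‖z - w‖ ^ 2 := by
    refine (div_le_iff₀ (by positivity)).2 ?_
    have h3 : 1 ≤ (‖z‖ ^ 2 + 0 ^ 2 + 1) * (‖w‖ ^ 2 + 0 ^ 2 + 1) :=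
      one_le_mul_of_one_le_of_one_le (by nlinarith [sq_nonneg ‖z‖]) (by nlinarith [sq_nonneg ‖w‖])
    have h4 : 0 ≤ 2 * ‖z - w‖ ^ 2 := by positivity
    nlinarith
  rw [mul_pow]
  linarith

theorem hausdorffEDist_pinchedCurve_le {ε : ℝ} (hε : 0 < ε) :
    Metric.hausdorffEDist (toSphere '' pinchedCurve ε) (toSphere '' limitSet) ≤
      ENNReal.ofReal (12 * ε) := by
  have hclose : ∀ (z : ℂ) (a b : ℝ), |a - z.re| ≤ 5 * ε → |b - z.im| ≤ ε →
      edist (toSphere z) (toSphere ((⟨a, b⟩ : ℂ) : CP1)) ≤ ENNReal.ofReal (12 * ε) := by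
    intro z a b ha hb
    rw [edist_dist]
    refine ENNReal.ofReal_le_ofReal ((dist_toSphere_coe_le _ _).trans ?_)
    have := norm_sub_le_abs_add_abs a b z
    rw [norm_sub_rev]
    linarith
  refine Metric.hausdorffEDist_le_of_mem_edist ?_ ?_
  · rintro _ ⟨c, hc, rfl⟩
    induction c using OnePoint.rec with
    | infty => exact ⟨_, ⟨_, infty_mem_limitSet, rfl⟩, by simp⟩
    | coe z =>
      rcases (coe_mem_pinchedCurve_iff hε).1 hc with ⟨h1, h2⟩ | ⟨h1, h2, h3⟩ | ⟨h1, h2⟩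
      · exact ⟨_, ⟨_, coe_mem_limitSet.2 (Or.inl ⟨h1, h2⟩), rfl⟩, by simp⟩
      · have h4 : 0 ≤ z.im / ε := by positivity
        have h5 : z.im / ε ≤ 1 := (div_le_one hε).2 h2
        refine ⟨_, ⟨((⟨2 - 4 * (z.im / ε), 0⟩ : ℂ) : CP1), coe_mem_limitSet.2 (Or.inr (Or.inl
          ⟨rfl, ?_, ?_⟩)), rfl⟩, hclose _ _ _ ?_ ?_⟩
        · change -2 ≤ 2 - 4 * (z.im / ε); linarith
        · change 2 - 4 * (z.im / ε) ≤ 2; linarith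
        · rw [h3, abs_le]; constructor <;> linarith
        · rw [abs_le]; constructor <;> linarith
      · exact ⟨_, ⟨_, coe_mem_limitSet.2 (Or.inr (Or.inr ⟨by linarith, by linarith⟩)), rfl⟩,
          by simp⟩
  · rintro _ ⟨c, hc, rfl⟩
    induction c using OnePoint.rec with
    | infty => exact ⟨_, ⟨_, infty_mem_pinchedCurve ε, rfl⟩, by simp⟩
    | coe z =>
      rcases coe_mem_limitSet.1 hc with ⟨h1, h2⟩ | ⟨h1, h2, h3⟩ | ⟨h1, h2⟩
      · exact ⟨_, ⟨_, (coe_mem_pinchedCurve_iff hε).2 (Or.inl ⟨h1, h2⟩), rfl⟩, by simp⟩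
      · have h4 : ε * ((2 - z.re) / 4) ≤ ε := mul_le_of_le_one_right hε.le (by linarith)
        have h5 : 0 ≤ ε * ((2 - z.re) / 4) := mul_nonneg hε.le (by linarith)
        refine ⟨_, ⟨((⟨z.re + ε * ((2 - z.re) / 4), ε * ((2 - z.re) / 4)⟩ : ℂ) : CP1),
          (coe_mem_pinchedCurve_iff hε).2 (Or.inr (Or.inl ⟨h5, h4, ?_⟩)), rfl⟩,
          hclose _ _ _ ?_ ?_⟩
        · simp only [mul_div_cancel_left₀ _ hε.ne']
          ring
        · rw [add_sub_cancel_left, abs_of_nonneg h5]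
          linarith
        · rw [h1, sub_zero, abs_of_nonneg h5]
          exact h4
      · rcases le_total ε z.im with h3 | h3
        · exact ⟨_, ⟨_, (coe_mem_pinchedCurve_iff hε).2 (Or.inr (Or.inr ⟨h3, by linarith⟩)), rfl⟩,
            by simp⟩
        · refine ⟨_, ⟨((⟨ε - 2, ε⟩ : ℂ) : CP1),
            (coe_mem_pinchedCurve_iff hε).2 (Or.inr (Or.inr ⟨le_rfl, rfl⟩)), rfl⟩,
            hclose _ _ _ ?_ ?_⟩
          · rw [abs_le]; constructor <;> linarith
          · rw [abs_le]; constructor <;> linarith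

/-! ### Degeneration of the quasicircle constants -/

/-- The height at which the vertical line over `x` meets the strand in the strip. -/
def strandHeight (ε x : ℝ) : ℝ := ε * (2 - x) / (4 - ε)

theorem strandHeight_bounds {ε x : ℝ} (hε : 0 < ε) (hε1 : ε ≤ 1) (hx : x ∈ Ioo (-(1 / 2)) 0) :
    0 < strandHeight ε x ∧ strandHeight ε x ≤ ε := by
  have h1 : 0 < 4 - ε := by linarith
  have h2 : 0 < 2 - x := by linarith [hx.2]
  refine ⟨by unfold strandHeight; positivity, ?_⟩
  rw [strandHeight, div_le_iff₀ h1]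
  exact mul_le_mul_of_nonneg_left (by linarith [hx.1]) hε.le

/-- The vertical segments in the wedge to the left of the peak, which join the rising strand to the
strand in the strip. -/
def segmentFamily (ε : ℝ) : Set C(I, CP1) :=
  (fun x => toCP1 (verticalPath x x (strandHeight ε x - x))) '' Ioo (-(1 / 2)) 0

theorem log_le_modulus_segmentFamily {ε : ℝ} (hε : 0 < ε) (hε1 : ε ≤ 1) :
    ENNReal.ofReal (Real.log ((1 / 2 + ε) / ε)) ≤ modulus (segmentFamily ε) := by
  have h := lintegral_inv_le_modulus (Γ := segmentFamily ε) (S := Ioo (-(1 / 2)) 0)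
    measurableSet_Ioo (y := fun x => x) (ℓ := fun x => strandHeight ε x - x)
    (fun x hx => by linarith [(strandHeight_bounds hε hε1 hx).1, hx.2]) fun x hx => ⟨x, hx, rfl⟩
  refine le_trans ?_ h
  have hint : ∫ x in (-(1 / 2) : ℝ)..0, (ε - x)⁻¹ = Real.log ((1 / 2 + ε) / ε) := by
    rw [intervalIntegral.integral_comp_sub_left (fun x => x⁻¹) ε, integral_inv_of_pos (by linarith)
      (by linarith)]
    congr 1
    ring
  have hcont : ContinuousOn (fun x : ℝ => (ε - x)⁻¹) (Icc (-(1 / 2)) 0) := by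
    refine ContinuousOn.inv₀ (by fun_prop) fun x hx => ?_
    have := hx.2
    linarith
  rw [← hint, intervalIntegral.integral_of_le (by norm_num), integral_Ioc_eq_integral_Ioo,
    ofReal_integral_eq_lintegral_ofReal]
  · refine setLIntegral_mono' measurableSet_Ioo fun x hx => ENNReal.ofReal_le_ofReal ?_
    have := strandHeight_bounds hε hε1 hx
    exact inv_anti₀ (by linarith [hx.2]) (by linarith)
  · exact (hcont.integrableOn_Icc).mono_set Ioo_subset_Icc_self
  · refine (ae_restrict_iff' measurableSet_Ioo).2 (ae_of_all _ fun x hx => ?_)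
    have := hx.2
    exact inv_nonneg.2 (by linarith)

/-- A path that joins the rising strand to the strand in the strip below the curve passes around the
triangle. -/
theorem modulus_reflected_le {ε : ℝ} (hε : 0 < ε) (hε1 : ε ≤ 1) {J : CP1 ≃ₜ CP1}
    (hJ : ∀ z ∈ pinchedCurve ε, J z = z) (hJ' : ∀ z ∉ pinchedCurve ε, J z ∉ pinchedCurve ε)
    (hJS : ∀ S : Set CP1, IsPreconnected S → Disjoint S (pinchedCurve ε) → ∀ z ∈ S, J z ∉ S) :
    modulus (imageFamily J (segmentFamily ε)) ≤ volume (Metric.closedBall (0 : ℂ) 2) := by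
  refine modulus_le_of_one_le_dist fun c hc => ?_
  obtain ⟨_, ⟨x, hx, rfl⟩, hγ⟩ := hc
  obtain ⟨hh0, hhε⟩ := strandHeight_bounds hε hε1 hx
  set ℓ := strandHeight ε x - x with hℓ
  have hx1 := hx.1
  have hx2 := hx.2
  have hℓ0 : 0 < ℓ := by linarith
  have h4ε : (4 - ε) ≠ 0 := by linarith
  have hpt : ∀ t : I, J ((verticalPath x x ℓ t : ℂ) : CP1) = (c t : CP1) := fun t =>
    congrArg (fun e : C(I, CP1) => e t) hγ
  have hv : ∀ t : I, verticalPath x x ℓ t = ⟨x, x + ℓ * t⟩ := fun t => rfl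
  have h0 : c 0 = ⟨x, x⟩ := by
    have h1 : (((⟨x, x⟩ : ℂ)) : CP1) ∈ pinchedCurve ε := by
      rw [coe_mem_pinchedCurve_iff hε]
      exact Or.inl ⟨by change x ≤ 2; linarith, (zigzag_of_nonpos hx2.le).symm⟩
    have h2 := hpt 0
    rw [hv] at h2
    simp only [Icc.coe_zero, mul_zero, add_zero] at h2
    rw [hJ _ h1] at h2
    exact (OnePoint.coe_injective h2).symm
  have h1 : c 1 = ⟨x, strandHeight ε x⟩ := by
    have h1 : (((⟨x, strandHeight ε x⟩ : ℂ)) : CP1) ∈ pinchedCurve ε := by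
      rw [coe_mem_pinchedCurve_iff hε]
      refine Or.inr (Or.inl ⟨hh0.le, hhε, ?_⟩)
      simp only [strandHeight]
      field_simp
      ring
    have h2 := hpt 1
    rw [hv] at h2
    simp only [Icc.coe_one, mul_one, hℓ, add_sub_cancel] at h2
    rw [hJ _ h1] at h2
    exact (OnePoint.coe_injective h2).symm
  -- The interior of each segment is above the curve, so its reflection is below the curve.
  have hmid : ∀ t : I, 0 < (t : ℝ) → (t : ℝ) < 1 → c t ∈ region ε false := by
    intro t ht0 ht1
    have habove : verticalPath x x ℓ t ∈ region ε true := by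
      rw [hv]
      have h2 : 0 < ℓ * t := by positivity
      have h3 : x + ℓ * t < strandHeight ε x := by nlinarith
      change zigzag (x + ramp ε (x + ℓ * t)) < x + ℓ * t
      rcases le_or_gt (x + ℓ * t) 0 with h4 | h4
      · rw [ramp_of_nonpos hε h4, add_zero, zigzag_of_nonpos hx2.le]
        linarith
      · rw [ramp_of_mem_Icc hε h4.le (by linarith)]
        refine (zigzag_le _).trans_lt (max_lt h4 ?_)
        set y := x + ℓ * t with hy
        rw [strandHeight, lt_div_iff₀ (by linarith)] at h3
        have h5 : y = ε * (y / ε) := by field_simp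
        have h6 : ε * (4 * (y / ε) - y) < ε * (2 - x) := by
          have : ε * (4 * (y / ε) - y) = y * (4 - ε) := by
            rw [mul_sub, mul_left_comm, ← h5]; ring
          rw [this]; exact h3
        have := lt_of_mul_lt_mul_left h6 hε.le
        linarith
    have hn := notMem_pinchedCurve_of_mem_region habove
    have hJn := hJ' _ hn
    rw [hpt] at hJn
    obtain ⟨i, hi⟩ := exists_mem_region hJn
    cases i
    · exact hi
    · exfalso
      refine hJS (((↑) : ℂ → CP1) '' region ε true)
        ((isPreconnected_region ε true).image _ OnePoint.continuous_coe.continuousOn) ?_ _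
        ⟨_, habove, rfl⟩ ?_
      · rw [disjoint_left]
        rintro _ ⟨z, hz, rfl⟩
        exact notMem_pinchedCurve_of_mem_region hz
      · rw [hpt]
        exact ⟨_, hi, rfl⟩
  refine ⟨?_, ?_⟩
  · rw [h0]
    refine (Complex.norm_le_abs_re_add_abs_im _).trans ?_
    change |x| + |x| ≤ 1
    rw [abs_of_neg hx2]
    linarith
  -- The reflected path crosses the real axis, which the region below the curve meets only to the
  -- right of the triangle.
  · obtain ⟨t, ht⟩ : ∃ t : I, (c t).im = 0 := by
      have := intermediate_value_univ (0 : I) 1 (Complex.continuous_im.comp c.continuous)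
      refine this ⟨?_, ?_⟩
      · simp only [Function.comp_apply, h0]; exact hx2.le
      · simp only [Function.comp_apply, h1]; exact hh0.le
    have ht0 : 0 < (t : ℝ) := by
      refine lt_of_le_of_ne t.2.1 fun h => ?_
      rw [show t = 0 from Subtype.ext h.symm, h0] at ht
      exact hx2.ne ht
    have ht1 : (t : ℝ) < 1 := by
      refine lt_of_le_of_ne t.2.2 fun h => ?_
      rw [show t = 1 from Subtype.ext h, h1] at ht
      exact hh0.ne' ht
    have h2 : (c t).im < zigzag ((c t).re + ramp ε (c t).im) := hmid t ht0 ht1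
    rw [ht, ramp_of_nonpos hε le_rfl, add_zero] at h2
    have h3 : 2 < (c t).re := by
      by_contra! h
      have := zigzag_le (c t).re
      rw [max_eq_left (by linarith)] at this
      linarith
    refine ⟨t, ?_⟩
    rw [dist_comm, dist_eq_norm]
    refine le_trans ?_ (Complex.abs_re_le_norm _)
    rw [Complex.sub_re, h0]
    exact le_trans (by change 1 ≤ (c t).re - x; linarith) (le_abs_self _)

/-- A lower bound for the quasicircle constant of a pinched curve, from the comparison of the two
sides of the curve. -/
theorem log_le_of_isQuasicircle {ε : ℝ} (hε : 0 < ε) (hε1 : ε ≤ 1) {K : ℝ}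
    (hK : IsQuasicircle K (pinchedCurve ε)) :
    Real.log ((1 / 2 + ε) / ε) ≤ K ^ 2 * (volume (Metric.closedBall (0 : ℂ) 2)).toReal := by
  obtain ⟨J, hJ, hJ', hJS, hmod⟩ := exists_reflection hK
  have hK1 : 1 ≤ K := by
    obtain ⟨-, f, hf, -⟩ := hK
    exact hf.1
  have hfin : volume (Metric.closedBall (0 : ℂ) 2) ≠ ∞ := measure_closedBall_lt_top.ne
  have hnc : ∀ γ ∈ segmentFamily ε, ∃ s t, γ s ≠ γ t := by
    rintro _ ⟨x, hx, rfl⟩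
    refine ⟨0, 1, fun h => ?_⟩
    have h1 := congrArg Complex.im (OnePoint.coe_injective h)
    have h2 : x + (strandHeight ε x - x) * ((0 : I) : ℝ) =
      x + (strandHeight ε x - x) * ((1 : I) : ℝ) := h1
    rw [Icc.coe_zero, Icc.coe_one] at h2
    linarith [(strandHeight_bounds hε hε1 hx).1, hx.2]
  have h := (log_le_modulus_segmentFamily hε hε1).trans ((hmod _ hnc).trans
    (mul_le_mul_right (modulus_reflected_le hε hε1 hJ hJ' hJS) _))
  rw [← ENNReal.ofReal_pow (by linarith), ← ENNReal.ofReal_toReal hfin,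
    ← ENNReal.ofReal_mul (by positivity), ENNReal.ofReal_le_ofReal_iff (by positivity)] at h
  exact h

end JordanWidth

end

theorem mainTheorem4 :
    ∃ M : ℝ, 0 < M ∧ ∃ (K : ℕ → ℝ) (C : ℕ → Set JordanWidth.CP1),
      (∀ n, JordanWidth.IsQuasicircle (K n) (C n)) ∧
      (∀ n, JordanWidth.IsPiecewiseCircular (C n)) ∧
      (∀ n, JordanWidth.width (C n) < ENNReal.ofReal M) ∧
      (∃ L : Set JordanWidth.CP1, IsClosed L ∧ JordanWidth.HausdorffTendsto C L ∧
        ¬ JordanWidth.IsJordanCurve L ∧ ¬ ∃ p, L = {p}) ∧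
      (∀ K' : ℕ → ℝ, (∀ n, JordanWidth.IsQuasicircle (K' n) (C n)) →
        Tendsto K' atTop atTop) := by
  set ε : ℕ → ℝ := fun n => 1 / ((n : ℝ) + 1) with hε
  have hε0 : ∀ n, 0 < ε n := fun n => Nat.one_div_pos_of_nat
  have hε1 : ∀ n, ε n ≤ 1 := fun n => by
    have : (0 : ℝ) ≤ n := n.cast_nonneg
    exact (div_le_one (by linarith)).2 (by linarith)
  have hεt : Tendsto ε atTop (𝓝 0) := tendsto_one_div_add_atTop_nhds_zero_nat
  set R := Real.arcosh (((16 + 2) ^ 2 + 2) / (1 / 4)) with hR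
  have hR0 : 0 ≤ R := Real.arcosh_nonneg (by norm_num)
  choose K hK using fun n => JordanWidth.isQuasicircle_pinchedCurve (ε n)
  refine ⟨R + R + 1, by positivity, K, fun n => JordanWidth.pinchedCurve (ε n), hK,
    fun n => JordanWidth.isPiecewiseCircular_pinchedCurve (hε0 n), fun n => ?_,
    ⟨JordanWidth.limitSet, JordanWidth.isClosed_limitSet, ?_,
      JordanWidth.not_isJordanCurve_limitSet, ?_⟩, fun K' hK' => ?_⟩
  · refine (JordanWidth.width_pinchedCurve_le (hε0 n) (hε1 n)).trans_lt ?_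
    rw [← ENNReal.ofReal_add hR0 hR0]
    exact (ENNReal.ofReal_lt_ofReal_iff (by positivity)).2 (by linarith)
  · have h : Tendsto (fun n => ENNReal.ofReal (12 * ε n)) atTop (𝓝 0) := by
      have := (ENNReal.continuous_ofReal.tendsto (12 * 0)).comp (hεt.const_mul 12)
      rwa [mul_zero, ENNReal.ofReal_zero] at this
    exact tendsto_of_tendsto_of_tendsto_of_le_of_le tendsto_const_nhds h (fun n => zero_le)
      fun n => JordanWidth.hausdorffEDist_pinchedCurve_le (hε0 n)
  · rintro ⟨p, hp⟩
    have h1 : OnePoint.infty = p := by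
      have := JordanWidth.infty_mem_limitSet
      rwa [hp] at this
    have h2 : ((0 : ℂ) : JordanWidth.CP1) = p := by
      have : ((0 : ℂ) : JordanWidth.CP1) ∈ JordanWidth.limitSet :=
        JordanWidth.coe_mem_limitSet.2 (Or.inr (Or.inl (by norm_num)))
      rwa [hp] at this
    exact OnePoint.infty_ne_coe _ (h1.trans h2.symm)
  · have hlog : Tendsto (fun n => Real.log ((1 / 2 + ε n) / ε n)) atTop atTop := by
      refine Real.tendsto_log_atTop.comp ?_
      have h1 : ∀ n, (1 / 2 + ε n) / ε n = (n : ℝ) / 2 + 3 / 2 := fun n => by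
        have : (n : ℝ) + 1 ≠ 0 := by positivity
        simp only [hε]
        field_simp
        ring
      simp_rw [h1]
      exact tendsto_atTop_add_const_right _ _
        (tendsto_natCast_atTop_atTop.atTop_div_const two_pos)
    set B := (volume (Metric.closedBall (0 : ℂ) 2)).toReal with hB
    have hle : ∀ n, Real.log ((1 / 2 + ε n) / ε n) ≤ K' n ^ 2 * B := fun n =>
      JordanWidth.log_le_of_isQuasicircle (hε0 n) (hε1 n) (hK' n)
    have h1 : ∀ n, 1 ≤ K' n := fun n => by
      obtain ⟨-, f, hf, -⟩ := hK' n
      exact hf.1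
    have h2 := tendsto_atTop_mono hle hlog
    rw [tendsto_atTop] at h2 ⊢
    intro b
    filter_upwards [h2 (b ^ 2 * B + 1)] with n hn
    by_contra! hb
    have h3 : K' n ^ 2 ≤ b ^ 2 := pow_le_pow_left₀ (by linarith [h1 n]) hb.le 2
    have h4 : K' n ^ 2 * B ≤ b ^ 2 * B := mul_le_mul_of_nonneg_right h3 ENNReal.toReal_nonneg
    linarith
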